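/- Let $n,k,i$ be integers with $0\le k\le n-1$ and $i>0$, and let $[n]=\{1,\dots,n\}$. Permutations $\sigma\in S_n$ are identified with the words $\sigma(1)\sigma(2)\cdots\sigma(n)$. For a word $w=w_1\cdots w_\ell$ with distinct positive integer letters, let $\mathsf{des}(w)$ be the number of $j\in\{1,\dots,\ell-1\}$ with $w_j>w_{j+1}$ (the descents of $w$), let $\mathsf{inv}(w)$ be the number of pairs $a<b$ with $w_a>w_b$, and put $w_0=0$. * Let $\mathcal S_{n,k+1}$ be the set of pairs $(\alpha_0,\rho)$, where $\rho=\rho_1\cdots\rho_{k+1}$ is a word made of $k+1$ different numbers of $[n]$ and $\alpha_0=[n]\setminus\{\rho_1,\dots,\rho_{k+1}\}$. Put $\mathsf{des}(\alpha_0,\rho)=\mathsf{des}(\rho)+\#\{a\in\alpha_0: a>\rho_1\}$. * If $w$ is increasing, its special reverse wave and its special wave are both $w$. Otherwise let $t$ be the minimal index with $w_t>w_{t+1}$. The special reverse wave of $w$ is the prefix $w_1\cdots w_s$, where $t\le s\le\ell$ is maximal such that $w_t>w_{t+1}>\cdots>w_s>w_{t-1}$. The special wave of $w$ is $w_rw_{r+1}\cdots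 w_s$, where $1\le r\le t$ is minimal such that $w_r>w_{t+1}$, and $t<s\le\ell$ is maximal such that $w_{t+1}>w_{t+2}>\cdots>w_s>w_{r-1}$. * A hook is a word $a_1a_2\cdots a_s$ with $s\ge2$, $a_1>a_2$ and $a_2<a_3<\cdots<a_s$. Every $w$ has a unique factorization as a concatenation $w=\gamma\,\alpha^{(1)}\cdots\alpha^{(m)}$, $m\ge0$, with $\gamma$ increasing (possibly empty) and every $\alpha^{(j)}$ a hook. Put $\mathsf{lec}(w)=\sum_{j=1}^m\mathsf{inv}(\alpha^{(j)})$. The rightmost hook of $w$ is $\alpha^{(m)}$ (and $\gamma=w$ if $m=0$). Then the following four sets have the same cardinality: 1. the set of $(\alpha_0,\rho)\in\mathcal S_{n,k+1}$ with $\mathsf{des}(\alpha_0,\rho)=i$; 2. the set of $\sigma\in S_n$ with $\mathsf{des}(\sigma)=i$ whose special reverse wave has length at least $n-k$; 3. the set of $\sigma\in S_n$ with $\mathsf{des}(\sigma)=i$ whose special wave has length at least $n-k$; 4. the set of $\sigma\in S_n$ with $\mathsf{lec}(\sigma)=i$ whose rightmost hook has length at least $n-k$. -/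

import Mathlib

namespace Eulerian

/-!
Words are lists of natural numbers; letters are numbered from `1`, as `w₁ w₂ ⋯ w_ℓ`.
-/

/-- The `j`-th letter `w_j` of a word, for `1 ≤ j ≤ ℓ`, with the convention `w_0 = 0`
(indices `j > ℓ` are never used below; there the value is `0`). -/
def letter (w : List ℕ) (j : ℕ) : ℕ := (0 :: w).getD j 0

/-- The set of positions `1 ≤ j ≤ ℓ - 1` with `w_j > w_{j+1}`. -/
def descents (w : List ℕ) : Finset ℕ :=
  (Finset.Ico 1 w.length).filter fun j => letter w (j + 1) < letter w j

/-- The number of descents of a word. -/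
def des (w : List ℕ) : ℕ := (descents w).card

/-- The number of inversions of a word: pairs `1 ≤ i < j ≤ ℓ` with `w_i > w_j`. -/
def inv (w : List ℕ) : ℕ :=
  ((Finset.Icc 1 w.length ×ˢ Finset.Icc 1 w.length).filter fun p =>
    p.1 < p.2 ∧ letter w p.2 < letter w p.1).card

/-- The word `σ(1) σ(2) ⋯ σ(n)` of a permutation of `[n] = {1, …, n}`
(the element `x : Fin n` stands for the number `x + 1`). -/
def word {n : ℕ} (σ : Equiv.Perm (Fin n)) : List ℕ := List.ofFn fun j => (σ j : ℕ) + 1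

/-! ### Semipermutations -/

/-- The set `S_{n,m}` of pairs `(α₀, ρ)`, where `ρ` is a word made of `m` different numbers of
`[n]` and `α₀ = [n] \ {ρ₁, …, ρ_m}`. -/
def semiperms (n m : ℕ) : Set (Finset ℕ × List ℕ) :=
  {p | p.2.length = m ∧ p.2.Nodup ∧ (∀ x ∈ p.2, x ∈ Finset.Icc 1 n) ∧
    p.1 = Finset.Icc 1 n \ p.2.toFinset}

/-- The number of descents of `(α₀, ρ)`: the descents of the word `ρ` together with the elements
of `α₀` that are larger than `ρ₁`. -/
def semides (p : Finset ℕ × List ℕ) : ℕ :=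
  des p.2 + (p.1.filter fun a => letter p.2 1 < a).card

/-- `w_a > w_{a+1} > ⋯ > w_b`. -/
def Decreasing (w : List ℕ) (a b : ℕ) : Prop :=
  ∀ j ∈ Finset.Ico a b, letter w (j + 1) < letter w j

instance (w : List ℕ) (a b : ℕ) : Decidable (Decreasing w a b) :=
  inferInstanceAs (Decidable (∀ j ∈ Finset.Ico a b, letter w (j + 1) < letter w j))

/-! ### Special reverse waves -/

/-- The position `t` of the first descent of a word that has a descent. -/
def firstDescent (w : List ℕ) (h : (descents w).Nonempty) : ℕ := (descents w).min' h

/-- For `t` the first descent, the maximal `s` with `t ≤ s ≤ ℓ` and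
`w_t > w_{t+1} > ⋯ > w_s > w_{t-1}`. -/
def srwEnd (w : List ℕ) (t : ℕ) : ℕ :=
  Nat.findGreatest (fun s => t ≤ s ∧ Decreasing w t s ∧
    letter w (t - 1) < letter w s) w.length

/-- The special reverse wave: the prefix `w_1 ⋯ w_s`, or `w` itself if `w` has no descents. -/
def srw (w : List ℕ) : List ℕ :=
  if h : (descents w).Nonempty then w.take (srwEnd w (firstDescent w h)) else w

/-! ### Special waves -/

theorem exists_gt_firstDescent (w : List ℕ) (h : (descents w).Nonempty) :
    ∃ r, 1 ≤ r ∧ r ≤ firstDescent w h ∧ letter w (firstDescent w h + 1) < letter w r := by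
  have hm := (descents w).min'_mem h
  simp only [descents, Finset.mem_filter, Finset.mem_Ico] at hm
  exact ⟨firstDescent w h, hm.1.1, le_rfl, hm.2⟩

/-- For `t` the first descent, the minimal `r` with `1 ≤ r ≤ t` and `w_r > w_{t+1}`. -/
def swStart (w : List ℕ) (h : (descents w).Nonempty) : ℕ := Nat.find (exists_gt_firstDescent w h)

/-- For `t` the first descent and `r` as above, the maximal `s` with `t < s ≤ ℓ` and
`w_{t+1} > w_{t+2} > ⋯ > w_s > w_{r-1}`. -/
def swEnd (w : List ℕ) (t r : ℕ) : ℕ :=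
  Nat.findGreatest (fun s => t < s ∧ Decreasing w (t + 1) s ∧
    letter w (r - 1) < letter w s) w.length

/-- The special wave: the subword `w_r ⋯ w_s`, or `w` itself if `w` has no descents. -/
def sw (w : List ℕ) : List ℕ :=
  if h : (descents w).Nonempty then
    (w.take (swEnd w (firstDescent w h) (swStart w h))).drop (swStart w h - 1)
  else w

/-! ### Hook factorization -/

/-- A (nontrivial) hook: a word `a_1 a_2 ⋯ a_s`, `s ≥ 2`, with `a_1 > a_2` and
`a_2 < a_3 < ⋯ < a_s`. -/
def IsHook (α : List ℕ) : Prop :=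
  ∃ (a b : ℕ) (v : List ℕ), α = a :: b :: v ∧ b < a ∧ (b :: v).Pairwise (· < ·)

/-- `w = γ * α_1 * ⋯ * α_k` with `γ` increasing (possibly empty) and every `α_i` a hook. -/
def IsHookFactorization (w γ : List ℕ) (αs : List (List ℕ)) : Prop :=
  w = γ ++ αs.flatten ∧ γ.Pairwise (· < ·) ∧ ∀ α ∈ αs, IsHook α

/-- The hook factorization `(γ, [α_1, …, α_k])` of a word with distinct letters, computed by
reading the word from right to left; `isHookFactorization_iff` shows that it is the unique
factorization in the sense of `IsHookFactorization`. -/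
def hookFactorization : List ℕ → List ℕ × List (List ℕ)
  | [] => ([], [])
  | a :: w =>
    match hookFactorization w with
    | ([], αs) => ([a], αs)
    | (b :: γ, αs) => if a < b then (a :: b :: γ, αs) else ([], (a :: b :: γ) :: αs)

theorem hookFactorization_append (γ v : List ℕ) (αs : List (List ℕ)) (hγ : γ.Pairwise (· < ·))
    (hv : hookFactorization v = ([], αs)) : hookFactorization (γ ++ v) = (γ, αs) := by
  induction γ with
  | nil => simpa using hv
  | cons a γ ih =>
    rw [List.pairwise_cons] at hγ
    have h := ih hγ.2
    cases γ with
    | nil => simp only [List.cons_append, hookFactorization, h]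
    | cons b γ =>
      have hab : a < b := hγ.1 b (by simp)
      rw [List.cons_append, hookFactorization, h]
      simp [hab]

/-- Existence and uniqueness of the hook factorization of a word with distinct letters. -/
theorem isHookFactorization_iff {w : List ℕ} (hw : w.Nodup) (γ : List ℕ) (αs : List (List ℕ)) :
    IsHookFactorization w γ αs ↔ hookFactorization w = (γ, αs) := by
  constructor
  · rintro ⟨rfl, hγ, hα⟩
    clear hw
    refine hookFactorization_append γ _ αs hγ ?_
    clear hγ
    induction αs with
    | nil => rfl
    | cons α αs ih =>
      obtain ⟨a, b, v, rfl, hba, hbv⟩ := hα α (by simp)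
      have h := hookFactorization_append (b :: v) _ αs hbv (ih fun α h => hα α (by simp [h]))
      rw [List.flatten_cons, List.cons_append, hookFactorization, h]
      simp [not_lt.2 hba.le]
  · intro h
    induction w generalizing γ αs with
    | nil =>
      simp only [hookFactorization, Prod.mk.injEq] at h
      obtain ⟨rfl, rfl⟩ := h
      simp [IsHookFactorization]
    | cons a w ih =>
      have hnd := List.nodup_cons.1 hw
      rcases hf : hookFactorization w with ⟨_ | ⟨b, δ⟩, βs⟩
      · obtain ⟨h1, h2, h3⟩ := ih hnd.2 _ _ hf
        simp only [hookFactorization, hf, Prod.mk.injEq] at h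
        obtain ⟨rfl, rfl⟩ := h
        exact ⟨by simp [h1], by simp, h3⟩
      · obtain ⟨h1, h2, h3⟩ := ih hnd.2 _ _ hf
        simp only [hookFactorization, hf] at h
        split_ifs at h with hab
        · simp only [Prod.mk.injEq] at h
          obtain ⟨rfl, rfl⟩ := h
          refine ⟨by simp [h1], ?_, h3⟩
          refine List.pairwise_cons.2 ⟨fun x hx => ?_, h2⟩
          rcases List.mem_cons.1 hx with rfl | hx
          · exact hab
          · exact hab.trans ((List.pairwise_cons.1 h2).1 x hx)
        · simp only [Prod.mk.injEq] at h
          obtain ⟨rfl, rfl⟩ := h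
          refine ⟨by simp [h1], List.Pairwise.nil, fun α hα => ?_⟩
          rcases List.mem_cons.1 hα with rfl | hα
          · have hne : a ≠ b := by
              rintro rfl
              exact hnd.1 (by simp [h1])
            exact ⟨a, b, δ, rfl, by omega, h2⟩
          · exact h3 α hα

/-- The statistic `lec`: the total number of inversions of the hooks `α_1, …, α_k`. -/
def lec (w : List ℕ) : ℕ := ((hookFactorization w).2.map inv).sum

/-- The rightmost hook `α_k`; it is the trivial hook `γ = w` if there are no hooks (`k = 0`). -/
def rightmostHook (w : List ℕ) : List ℕ :=
  (hookFactorization w).2.getLast?.getD (hookFactorization w).1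

end Eulerian

namespace Eulerian

/-! Sets 2, 3 and 4 are compared through one common recursion. A word on a finite set `S` of
positive letters that is not increasing is determined by a triple `(P, j, v)`: `P` is the letter set
of its wave or rightmost hook, `v` is the word on `S \ P` left after deleting those letters, and `j`
with `1 ≤ j < #P` is what the deleted block contributes to the statistic. Every such triple occurs,
the statistic of the word is `j` plus that of `v`, and the block has length `#P`. `IsWaveCoding`
axiomatizes this, and `isWaveCoding_srw`, `isWaveCoding_sw` and `isWaveCoding_hook` establish it for
the three pairs of statistic and block.

The recursion has the same shape in all three cases. Strong induction on `S` therefore yields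
statistic-preserving bijections between words (`exists_bijOn`). Applying these to the component `v`
alone leaves `P` and `j` fixed, so the total statistic and the block length are both preserved
(`mk_eq`). Since `j ≥ 1`, statistic zero means increasing; for `i > 0` the increasing words play no
role.

Set 1 is matched with set 2 directly. A pair `(α₀, ρ)` is written as the letters of `α₀` below `ρ₁`
increasingly, those above `ρ₁` decreasingly, then `ρ`. Each letter of `α₀` above `ρ₁` starts a
descent and each one below starts none, so the descent numbers agree. A word has this form, with `ρ`
of length `k + 1`, exactly when its special reverse wave covers the first `n - k` letters
(`bijOn_semiWord`). -/

/-! ### Letters, descents and inversions under concatenation. -/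

theorem letter_succ (w : List ℕ) (j : ℕ) : letter w (j + 1) = w.getD j 0 := by
  simp [letter]

theorem letter_cons (x : ℕ) (w : List ℕ) (j : ℕ) (hj : 1 ≤ j) :
    letter (x :: w) (j + 1) = letter w j := by
  obtain ⟨j, rfl⟩ := Nat.exists_eq_add_of_le' hj
  simp [letter]

theorem letter_append_left (a b : List ℕ) (j : ℕ) (hj : j ≤ a.length) :
    letter (a ++ b) j = letter a j := by
  cases j with
  | zero => simp [letter]
  | succ j => rw [letter_succ, letter_succ, List.getD_append _ _ _ _ (by omega)]

theorem letter_append_right (a b : List ℕ) (j : ℕ) (hj : 1 ≤ j) :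
    letter (a ++ b) (a.length + j) = letter b j := by
  obtain ⟨j, rfl⟩ := Nat.exists_eq_add_of_le' hj
  rw [← add_assoc, letter_succ, letter_succ, List.getD_append_right _ _ _ _ (by omega)]
  simp

/-- The default `0` is the convention `w_0 = 0`: the letter preceding a block is the last letter of
the prefix `a`, or `0` when `a` is empty. This is why `getLastD 0` serves as the lower bound of
waves throughout. -/
theorem letter_length (a : List ℕ) : letter a a.length = a.getLastD 0 := by
  rcases List.eq_nil_or_concat a with rfl | ⟨a, x, rfl⟩
  · simp [letter]
  · simp [letter]

theorem letter_mem (w : List ℕ) (j : ℕ) (h1 : 1 ≤ j) (h2 : j ≤ w.length) : letter w j ∈ w := by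
  obtain ⟨j, rfl⟩ := Nat.exists_eq_add_of_le' h1
  rw [letter_succ, List.getD_eq_getElem _ _ (by omega)]
  exact List.getElem_mem _

theorem pairwise_iff_letter {R : ℕ → ℕ → Prop} (w : List ℕ) :
    w.Pairwise R ↔ ∀ i j, 1 ≤ i → i < j → j ≤ w.length → R (letter w i) (letter w j) := by
  rw [List.pairwise_iff_getElem]
  constructor
  · intro h i j hi hij hj
    obtain ⟨i, rfl⟩ := Nat.exists_eq_add_of_le' hi
    obtain ⟨j, rfl⟩ := Nat.exists_eq_add_of_le' (hi.trans hij.le)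
    rw [letter_succ, letter_succ, List.getD_eq_getElem _ _ (by omega),
      List.getD_eq_getElem _ _ (by omega)]
    exact h i j (by omega) (by omega) (by omega)
  · intro h i j hi hj hij
    have := h (i + 1) (j + 1) (by omega) (by omega) (by omega)
    rwa [letter_succ, letter_succ, List.getD_eq_getElem _ _ (by omega),
      List.getD_eq_getElem _ _ (by omega)] at this

theorem sum_letter (f : ℕ → ℕ) (w : List ℕ) :
    ∑ j ∈ Finset.Ico 1 (w.length + 1), f (letter w j) = (w.map f).sum := by
  induction w with
  | nil => simp
  | cons x w ih =>
    rw [List.length_cons, Finset.sum_eq_sum_Ico_succ_bot (by omega), List.map_cons, List.sum_cons,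
      ← ih, ← Finset.sum_Ico_add' _ 1 (w.length + 1) 1]
    congr 1
    refine Finset.sum_congr rfl fun j hj => ?_
    rw [letter_cons _ _ _ (Finset.mem_Ico.1 hj).1]

@[simp]
theorem des_singleton (x : ℕ) : des [x] = 0 := rfl

theorem des_cons_cons (x y : ℕ) (w : List ℕ) :
    des (x :: y :: w) = (if y < x then 1 else 0) + des (y :: w) := by
  simp only [des, descents, Finset.card_filter]
  rw [List.length_cons, Finset.sum_eq_sum_Ico_succ_bot (by simp), List.length_cons,
    ← Finset.sum_Ico_add' _ 1 (w.length + 1) 1]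
  congr 1
  refine Finset.sum_congr rfl fun j hj => ?_
  rw [letter_cons _ _ _ (Finset.mem_Ico.1 hj).1, letter_cons _ _ _ (by omega)]

theorem des_append_cons (u : List ℕ) (x : ℕ) (v : List ℕ) :
    des (u ++ x :: v) = des (u ++ [x]) + des (x :: v) := by
  induction u with
  | nil => simp
  | cons a u ih =>
    cases u with
    | nil => simp [des_cons_cons]
    | cons b u =>
      simp only [List.cons_append] at ih ⊢
      rw [des_cons_cons, des_cons_cons a b (u ++ [x]), ih, add_assoc]

theorem des_eq_zero_of_pairwise {w : List ℕ} (h : w.Pairwise (· < ·)) : des w = 0 := by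
  induction w with
  | nil => rfl
  | cons x w ih =>
    cases w with
    | nil => rfl
    | cons y w =>
      rw [List.pairwise_cons] at h
      rw [des_cons_cons, ih h.2, if_neg (not_lt.2 (h.1 y (by simp)).le)]

theorem des_cons_of_pairwise_gt {x : ℕ} {w : List ℕ} (h : (x :: w).Pairwise (· > ·)) :
    des (x :: w) = w.length := by
  induction w generalizing x with
  | nil => rfl
  | cons y w ih =>
    rw [List.pairwise_cons] at h
    rw [des_cons_cons, ih h.2, if_pos (h.1 y (by simp)), List.length_cons, add_comm]

theorem inv_cons (x : ℕ) (w : List ℕ) :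
    inv (x :: w) = (w.filter (· < x)).length + inv w := by
  have key : ∀ w : List ℕ, inv w = ∑ i ∈ Finset.Ico 1 (w.length + 1),
      ∑ j ∈ Finset.Ico 1 (w.length + 1), if i < j ∧ letter w j < letter w i then 1 else 0 := by
    intro w
    simp only [inv, Finset.card_filter]
    rw [Finset.sum_product]
    rfl
  -- Peel off the row of `x`, which counts the smaller letters after it. In every other row the
  -- column of `x` contributes nothing, because `x` comes first.
  rw [key, key w, List.length_cons, Finset.sum_eq_sum_Ico_succ_bot (by omega)]
  rw [← Finset.sum_Ico_add' _ 1 (w.length + 1) 1]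
  congr 1
  · rw [Finset.sum_eq_sum_Ico_succ_bot (by omega), ← Finset.sum_Ico_add' _ 1 (w.length + 1) 1]
    rw [← List.countP_eq_length_filter]
    have := sum_letter (fun y => if y < x then 1 else 0) w
    have hc : w.countP (fun y => decide (y < x)) = (w.map fun y => if y < x then 1 else 0).sum := by
      clear this
      induction w with
      | nil => rfl
      | cons y w ih => by_cases h : y < x <;> simp [h, ih, add_comm]
    rw [hc, ← this]
    simp only [lt_self_iff_false, false_and, if_false, zero_add]
    refine Finset.sum_congr rfl fun j hj => ?_
    rw [letter_cons _ _ _ (Finset.mem_Ico.1 hj).1]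
    have : 1 < j + 1 := by have := (Finset.mem_Ico.1 hj).1; omega
    simp [this, letter_succ]
  · refine Finset.sum_congr rfl fun i hi => ?_
    rw [Finset.sum_eq_sum_Ico_succ_bot (by omega), ← Finset.sum_Ico_add' _ 1 (w.length + 1) 1]
    have hi := (Finset.mem_Ico.1 hi).1
    rw [if_neg (by omega), zero_add]
    refine Finset.sum_congr rfl fun j hj => ?_
    rw [letter_cons _ _ _ (Finset.mem_Ico.1 hj).1, letter_cons _ _ _ hi]
    simp
-- Recognizing waves and hooks in a concatenated word.
theorem mem_descents {w : List ℕ} {j : ℕ} :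
    j ∈ descents w ↔ 1 ≤ j ∧ j < w.length ∧ letter w (j + 1) < letter w j := by
  simp [descents, and_assoc]

theorem not_nonempty_descents_of_pairwise {w : List ℕ} (h : w.Pairwise (· < ·)) :
    ¬ (descents w).Nonempty := by
  rw [Finset.not_nonempty_iff_eq_empty, ← Finset.card_eq_zero]
  exact des_eq_zero_of_pairwise h

theorem firstDescent_eq {w : List ℕ} {t : ℕ} (h : t ∈ descents w)
    (hlt : (w.take t).Pairwise (· < ·)) : firstDescent w ⟨t, h⟩ = t := by
  refine le_antisymm (Finset.min'_le _ _ h) (Finset.le_min' _ _ _ fun j hj => ?_)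
  by_contra! hjt
  have h1 := mem_descents.1 h
  have h2 := mem_descents.1 hj
  have h3 := (pairwise_iff_letter _).1 hlt j (j + 1) h2.1 (by omega) (by simp; omega)
  have h4 : ∀ i ≤ t, letter (w.take t) i = letter w i := fun i hi => by
    conv_rhs => rw [← List.take_append_drop t w]
    rw [letter_append_left]
    simp; omega
  rw [h4 _ (by omega), h4 _ (by omega)] at h3
  omega

theorem decreasing_append_iff (a d v : List ℕ) :
    Decreasing (a ++ d ++ v) (a.length + 1) (a.length + d.length) ↔ d.Pairwise (· > ·) := by
  have hl : ∀ i, 1 ≤ i → i ≤ d.length → letter (a ++ d ++ v) (a.length + i) = letter d i := by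
    intro i h1 h2
    rw [letter_append_left _ _ _ (by simp; omega), letter_append_right _ _ _ h1]
  have hd : d.Pairwise (· > ·) ↔ d.IsChain (· > ·) := List.isChain_iff_pairwise.symm
  rw [hd, List.isChain_iff_getElem]
  constructor
  · intro h i hi
    have := h (a.length + (i + 1)) (Finset.mem_Ico.2 (by omega))
    rw [add_assoc, hl _ (by omega) (by omega), hl _ (by omega) (by omega), letter_succ, letter_succ,
      List.getD_eq_getElem _ _ (by omega), List.getD_eq_getElem _ _ (by omega)] at this
    exact this
  · intro h i hi
    have hi := Finset.mem_Ico.1 hi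
    obtain ⟨i, rfl⟩ := Nat.exists_eq_add_of_le hi.1
    have := h i (by omega)
    rw [show a.length + 1 + i = a.length + (i + 1) by ring, add_assoc, hl _ (by omega) (by omega),
      hl _ (by omega) (by omega), letter_succ, letter_succ,
      List.getD_eq_getElem _ _ (by omega), List.getD_eq_getElem _ _ (by omega)]
    exact this

theorem Decreasing.letter_le {w : List ℕ} {a b : ℕ} (h : Decreasing w a b) {i j : ℕ} (hi : a ≤ i)
    (hij : i ≤ j) (hj : j ≤ b) : letter w j ≤ letter w i := by
  induction j, hij using Nat.le_induction with
  | base => rfl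
  | succ j hij ih =>
    exact (h j (Finset.mem_Ico.2 (by omega))).le.trans (ih (by omega))

/-- The end of a maximal decreasing block `d` whose letters exceed the bound `p`. -/
theorem findGreatest_decreasing (a d v : List ℕ) (p : ℕ) (hd : d.Pairwise (· > ·)) (hne : d ≠ [])
    (hp : p < d.getLastD 0) (hv : ∀ q ∈ v.head?, q < d.getLastD 0 → q ≤ p)
    {c : ℕ} (hc : c ≤ a.length + d.length) :
    Nat.findGreatest (fun s => c ≤ s ∧ Decreasing (a ++ d ++ v) (a.length + 1) s ∧
      p < letter (a ++ d ++ v) s) (a ++ d ++ v).length = a.length + d.length := by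
  have hpos : 1 ≤ d.length := List.length_pos_iff.2 hne
  have hlast : letter (a ++ d ++ v) (a.length + d.length) = d.getLastD 0 := by
    rw [letter_append_left _ _ _ (by simp), letter_append_right _ _ _ hpos, letter_length]
  refine (Nat.findGreatest_eq_iff).2 ⟨by simp, fun _ => ⟨hc, ?_, ?_⟩, ?_⟩
  · exact (decreasing_append_iff a d v).2 hd
  · rwa [hlast]
  · rintro s hs hsl ⟨-, h2, h3⟩
    cases v with
    | nil => simp at hsl; omega
    | cons q v =>
      have hq : letter (a ++ d ++ q :: v) (a.length + d.length + 1) = q := by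
        rw [← List.length_append, letter_append_right _ _ _ le_rfl, letter_succ]; rfl
      -- A longer decreasing run would contain `q`, hence `q ≤ p` by maximality; all later letters
      -- of the run are at most `q`, so its last letter cannot exceed `p`.
      have h4 := h2 (a.length + d.length) (Finset.mem_Ico.2 (by omega))
      rw [hq, hlast] at h4
      have h5 := hv q (by simp) h4
      have h6 := h2.letter_le (i := a.length + d.length + 1) (by omega) hs le_rfl
      omega

theorem srw_of_pairwise {w : List ℕ} (h : w.Pairwise (· < ·)) : srw w = w := by
  rw [srw, dif_neg (not_nonempty_descents_of_pairwise h)]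

/-- The first descent is at `x` whether or not `y` belongs to the wave: `d` may be `[x]` alone, with
`y` already at or below the last letter of `a`. -/
theorem srw_append (a : List ℕ) (x y : ℕ) (r d v : List ℕ) (ha : (a ++ [x]).Pairwise (· < ·))
    (hyx : y < x) (hw : x :: y :: r = d ++ v) (hne : d ≠ []) (hd : d.Pairwise (· > ·))
    (hp : a.getLastD 0 < d.getLastD 0)
    (hv : ∀ q ∈ v.head?, q < d.getLastD 0 → q ≤ a.getLastD 0) :
    srw (a ++ d ++ v) = a ++ d := by
  have hw' : a ++ d ++ v = a ++ [x] ++ y :: r := by simp [← hw]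
  have ht : a.length + 1 ∈ descents (a ++ d ++ v) := by
    rw [hw', mem_descents]
    refine ⟨by omega, by simp, ?_⟩
    rw [letter_append_left _ _ (a.length + 1) (by simp)]
    have := letter_append_right (a ++ [x]) (y :: r) 1 le_rfl
    rw [List.length_append] at this
    rw [List.length_singleton] at this
    rw [this, letter_append_right _ _ _ le_rfl]
    simpa [letter] using hyx
  rw [srw, dif_pos ⟨_, ht⟩, firstDescent_eq ht, srwEnd, Nat.add_sub_cancel]
  · rw [show letter (a ++ d ++ v) a.length = a.getLastD 0 by
      rw [List.append_assoc, letter_append_left _ _ _ le_rfl, letter_length]]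
    rw [findGreatest_decreasing a d v _ hd hne hp hv]
    · rw [List.take_left' (by simp)]
    · have := List.length_pos_iff.2 hne
      omega
  · rw [hw', List.take_left' (by simp)]
    exact ha

theorem sw_append (a b d v : List ℕ) (hab : (a ++ b).Pairwise (· < ·)) (hb : b ≠ [])
    (hne : d ≠ []) (hd : d.Pairwise (· > ·)) (hbd : ∀ x ∈ b, ∀ y ∈ d, y < x)
    (hp : a.getLastD 0 < d.getLastD 0)
    (hv : ∀ q ∈ v.head?, q < d.getLastD 0 → q ≤ a.getLastD 0) :
    sw (a ++ b ++ d ++ v) = b ++ d := by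
  have hbl := List.length_pos_iff.2 hb
  have hdl := List.length_pos_iff.2 hne
  have hw : a ++ b ++ d ++ v = (a ++ b) ++ (d ++ v) := by simp
  have l1 : letter (a ++ b ++ d ++ v) ((a ++ b).length + 1) = letter d 1 := by
    rw [hw, letter_append_right _ _ _ le_rfl, letter_append_left _ _ _ hdl]
  have l2 : ∀ j, 1 ≤ j → j ≤ b.length →
      letter (a ++ b ++ d ++ v) (a.length + j) = letter b j := by
    intro j h1 h2
    rw [hw, letter_append_left _ _ _ (by simp; omega), letter_append_right _ _ _ h1]
  have l3 : ∀ j, j ≤ a.length → letter (a ++ b ++ d ++ v) j = letter a j := by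
    intro j h1
    rw [hw, List.append_assoc, letter_append_left _ _ _ h1]
  have ht : (a ++ b).length ∈ descents (a ++ b ++ d ++ v) := by
    refine mem_descents.2 ⟨by simp; omega, by simp; omega, ?_⟩
    rw [l1, List.length_append, l2 _ hbl le_rfl]
    exact hbd _ (letter_mem _ _ hbl le_rfl) _ (letter_mem _ _ le_rfl hdl)
  have hf : firstDescent (a ++ b ++ d ++ v) ⟨_, ht⟩ = (a ++ b).length :=
    firstDescent_eq ht (by rw [hw, List.take_left' rfl]; exact hab)
  have hs : swStart (a ++ b ++ d ++ v) ⟨_, ht⟩ = a.length + 1 := by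
    refine (Nat.find_eq_iff (exists_gt_firstDescent _ ⟨_, ht⟩)).2 ?_
    rw [hf]
    refine ⟨⟨by omega, by simp; omega, ?_⟩, ?_⟩
    · rw [l1, l2 _ le_rfl hbl]
      exact hbd _ (letter_mem _ _ le_rfl hbl) _ (letter_mem _ _ le_rfl hdl)
    -- No letter of `a` exceeds the first letter of `d`: it is at most the last letter of `a`, which
    -- is below the last and smallest letter of `d`.
    · rintro j hj ⟨h1, -, h2⟩
      rw [l1, l3 _ (by omega)] at h2
      have h3 : letter a j ≤ a.getLastD 0 := by
        rw [← letter_length]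
        rcases Nat.lt_or_ge j a.length with h | h
        · exact ((pairwise_iff_letter _).1 (List.pairwise_append.1 hab).1 _ _ h1 h le_rfl).le
        · rw [show j = a.length by omega]
      have h4 : d.getLastD 0 ≤ letter d 1 := by
        rw [← letter_length]
        rcases Nat.lt_or_ge 1 d.length with h | h
        · exact ((pairwise_iff_letter _).1 hd _ _ le_rfl h le_rfl).le
        · rw [show d.length = 1 by omega]
      omega
  rw [sw, dif_pos ⟨_, ht⟩, hs, hf, swEnd, Nat.add_sub_cancel, l3 _ le_rfl, letter_length]
  have := findGreatest_decreasing (a ++ b) d v _ hd hne hp hv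
    (c := (a ++ b).length + 1) (by omega)
  simp only [Nat.lt_iff_add_one_le]
  simp only [Nat.lt_iff_add_one_le] at this
  rw [this, List.take_left' (by simp [add_assoc]), List.append_assoc, List.drop_left' rfl]

/-- Reading from the right, a completed hook leaves the pending increasing word empty, so the
factorization of `w` proceeds as if nothing followed. -/
theorem hookFactorization_append_hook (w : List ℕ) (a b : ℕ) (v : List ℕ) (hab : b < a)
    (hv : (b :: v).Pairwise (· < ·)) :
    hookFactorization (w ++ a :: b :: v) =
      ((hookFactorization w).1, (hookFactorization w).2 ++ [a :: b :: v]) := by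
  induction w with
  | nil =>
    have := hookFactorization_append (b :: v) [] [] hv rfl
    rw [List.append_nil] at this
    rw [List.nil_append, show hookFactorization [] = ([], []) from rfl, hookFactorization, this]
    simp [not_lt.2 hab.le]
  | cons x w ih =>
    rw [List.cons_append, hookFactorization, ih, hookFactorization]
    rcases hookFactorization w with ⟨_ | ⟨c, γ⟩, αs⟩
    · rfl
    · by_cases h : x < c <;> simp [h]

theorem hookFactorization_of_pairwise {w : List ℕ} (h : w.Pairwise (· < ·)) :
    hookFactorization w = (w, []) := by
  simpa using hookFactorization_append w [] [] h rfl

theorem lec_of_pairwise {w : List ℕ} (h : w.Pairwise (· < ·)) : lec w = 0 := by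
  simp [lec, hookFactorization_of_pairwise h]

theorem inv_of_pairwise {w : List ℕ} (h : w.Pairwise (· < ·)) : inv w = 0 := by
  induction w with
  | nil => rfl
  | cons x w ih =>
    rw [List.pairwise_cons] at h
    rw [inv_cons, ih h.2, List.filter_eq_nil_iff.2]
    · rfl
    · intro y hy
      simpa using (h.1 y hy).le

/-- The condition `hlong` guarantees that the first letter of `d` is a descent, either into `d`
itself or into `v`. -/
theorem srw_append_of_maximal (a d v : List ℕ) (ha : a.Pairwise (· < ·)) (hne : d ≠ [])
    (hd : d.Pairwise (· > ·)) (had : ∀ x ∈ a, ∀ y ∈ d, x < y) (h0 : 0 < d.getLastD 0)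
    (hv : ∀ q ∈ v.head?, q < d.getLastD 0 → q ≤ a.getLastD 0)
    (hlong : 2 ≤ d.length ∨ ∃ q ∈ v.head?, q < d.getLastD 0) :
    srw (a ++ d ++ v) = a ++ d := by
  have hp : a.getLastD 0 < d.getLastD 0 := by
    rcases List.eq_nil_or_concat a with rfl | ⟨a, x, rfl⟩
    · simpa using h0
    · rcases List.eq_nil_or_concat d with rfl | ⟨d, y, rfl⟩
      · simp at hne
      · simpa using had x (by simp) y (by simp)
  have hx : ∀ x ∈ d, (a ++ [x]).Pairwise (· < ·) := fun x hx => by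
    rw [List.pairwise_append]
    exact ⟨ha, by simp, fun y hy z hz => by
      rw [List.mem_singleton] at hz
      exact hz ▸ had y hy x hx⟩
  match d, v, hlong with
  | [], _, _ => exact absurd rfl hne
  | [x], [], h => simp at h
  | [x], q :: v, h =>
    exact srw_append a x q v [x] (q :: v) (hx x (by simp)) (by simpa using h) rfl hne hd hp hv
  | x :: y :: d, v, h =>
    exact srw_append a x y (d ++ v) (x :: y :: d) v (hx x (by simp))
      ((List.pairwise_cons.1 hd).1 y (by simp)) (by simp) hne hd hp hv

/-! ### Words on a finite set and the common recursion. -/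

/-- The words in which every element of `S` occurs exactly once. -/
def IsWordOn (S : Finset ℕ) (w : List ℕ) : Prop := (w : Multiset ℕ) = S.val

theorem IsWordOn.nodup {S : Finset ℕ} {w : List ℕ} (h : IsWordOn S w) : w.Nodup := by
  rw [← Multiset.coe_nodup, show (w : Multiset ℕ) = S.val from h]
  exact S.nodup

theorem IsWordOn.mem_iff {S : Finset ℕ} {w : List ℕ} (h : IsWordOn S w) (x : ℕ) :
    x ∈ w ↔ x ∈ S := by
  rw [← Multiset.mem_coe, show (w : Multiset ℕ) = S.val from h, Finset.mem_val]

theorem IsWordOn.length_eq {S : Finset ℕ} {w : List ℕ} (h : IsWordOn S w) :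
    w.length = S.card := by
  rw [← Multiset.coe_card, show (w : Multiset ℕ) = S.val from h, Finset.card_val]

theorem isWordOn_iff {S : Finset ℕ} {w : List ℕ} :
    IsWordOn S w ↔ w.Nodup ∧ ∀ x, x ∈ w ↔ x ∈ S := by
  refine ⟨fun h => ⟨h.nodup, h.mem_iff⟩, fun h => ?_⟩
  exact (Multiset.Nodup.ext (Multiset.coe_nodup.2 h.1) S.nodup).2 (by simpa using h.2)

/-- The triples `(P, j, v)` with `P ⊆ S`, `1 ≤ j < #P` and `v` a word on `S \ P`. -/
def triples (S : Finset ℕ) : Set (Finset ℕ × ℕ × List ℕ) :=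
  {x | x.1 ⊆ S ∧ 1 ≤ x.2.1 ∧ x.2.1 < x.1.card ∧ IsWordOn (S \ x.1) x.2.2}

/-- `code` builds the words with a descent by inserting into a word `v` a wave with letter set `P`
which contributes `j` to the statistic. -/
structure IsWaveCoding (stat : List ℕ → ℕ) (wave : List ℕ → List ℕ)
    (code : Finset ℕ × ℕ × List ℕ → List ℕ) : Prop where
  stat_of_pairwise : ∀ w : List ℕ, w.Pairwise (· < ·) → stat w = 0
  code_eq : ∀ S : Finset ℕ, 0 ∉ S → ∀ x ∈ triples S, ∃ u W v : List ℕ, x.2.2 = u ++ v ∧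
    W.Perm x.1.sort ∧ code x = u ++ W ++ v ∧ wave (code x) = W ∧
    stat (code x) = x.2.1 + stat x.2.2
  surj : ∀ S : Finset ℕ, 0 ∉ S → ∀ w, IsWordOn S w → ¬ w.Pairwise (· < ·) →
    ∃ x ∈ triples S, code x = w

namespace IsWaveCoding

variable {stat : List ℕ → ℕ} {wave : List ℕ → List ℕ} {code : Finset ℕ × ℕ × List ℕ → List ℕ}

/-- Injectivity comes from reading the triple back: `P` is the letter set of the wave, `v` is what
remains after deleting `P`, and `j` is the difference of the statistics. The image has no increasing
word because `j ≥ 1` forces a positive statistic. -/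
theorem bijOn (hc : IsWaveCoding stat wave code) {S : Finset ℕ} (hS : 0 ∉ S) :
    Set.BijOn code (triples S) {w | IsWordOn S w ∧ ¬ w.Pairwise (· < ·)} := by
  refine ⟨fun x hx => ?_, fun x hx y hy hxy => ?_, fun w hw => ?_⟩
  · obtain ⟨u, W, v, h1, h2, h3, -, h5⟩ := hc.code_eq S hS x hx
    obtain ⟨g1, g2, g3, g4⟩ := hx
    refine ⟨?_, fun h => ?_⟩
    · have hW : (W : Multiset ℕ) = x.1.val := by
        rw [← Finset.sort_eq x.1 (· ≤ ·)]
        exact Multiset.coe_eq_coe.2 h2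
      rw [h1, IsWordOn, ← Multiset.coe_add] at g4
      rw [IsWordOn, h3, ← Multiset.coe_add, ← Multiset.coe_add, add_right_comm, g4, hW,
        Finset.sdiff_val, tsub_add_cancel_of_le (Finset.val_le_iff.2 g1)]
    · have := hc.stat_of_pairwise _ h
      omega
  · have key : ∀ x ∈ triples S, x.1 = (wave (code x)).toFinset ∧
        x.2.2 = (code x).filter (· ∉ x.1) ∧ x.2.1 = stat (code x) - stat x.2.2 := by
      intro x hx
      obtain ⟨u, W, v, h1, h2, h3, h4, h5⟩ := hc.code_eq S hS x hx
      refine ⟨?_, ?_, by omega⟩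
      · rw [h4, List.toFinset_eq_of_perm _ _ h2, Finset.sort_toFinset]
      · have hW : W.filter (· ∉ x.1) = [] := by
          rw [List.filter_eq_nil_iff]
          intro y hy
          simpa using (Finset.mem_sort _).1 (h2.mem_iff.1 hy)
        have hv : (u ++ v).filter (· ∉ x.1) = u ++ v := by
          rw [List.filter_eq_self]
          intro y hy
          rw [← h1, hx.2.2.2.mem_iff] at hy
          simpa using (Finset.mem_sdiff.1 hy).2
        rw [h3, List.filter_append, List.filter_append, hW, List.append_nil, ← List.filter_append,
          hv, h1]
    obtain ⟨a1, a2, a3⟩ := key x hx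
    obtain ⟨b1, b2, b3⟩ := key y hy
    have e1 : x.1 = y.1 := by rw [a1, b1, hxy]
    have e2 : x.2.2 = y.2.2 := by rw [a2, b2, hxy, e1]
    have e3 : x.2.1 = y.2.1 := by rw [a3, b3, hxy, e2]
    exact Prod.ext e1 (Prod.ext e3 e2)
  · exact hc.surj S hS w hw.1 hw.2

theorem stat_code (hc : IsWaveCoding stat wave code) {S : Finset ℕ} (hS : 0 ∉ S)
    {x : Finset ℕ × ℕ × List ℕ} (hx : x ∈ triples S) : stat (code x) = x.2.1 + stat x.2.2 := by
  obtain ⟨u, W, v, -, -, -, -, h⟩ := hc.code_eq S hS x hx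
  exact h

theorem length_wave_code (hc : IsWaveCoding stat wave code) {S : Finset ℕ} (hS : 0 ∉ S)
    {x : Finset ℕ × ℕ × List ℕ} (hx : x ∈ triples S) : (wave (code x)).length = x.1.card := by
  obtain ⟨u, W, v, -, h2, -, h4, -⟩ := hc.code_eq S hS x hx
  rw [h4, h2.length_eq, Finset.length_sort]

theorem bijOn_of_pos (hc : IsWaveCoding stat wave code) {S : Finset ℕ} (hS : 0 ∉ S) {i : ℕ}
    (hi : 0 < i) (m : ℕ) :
    Set.BijOn code {x | x ∈ triples S ∧ x.2.1 + stat x.2.2 = i ∧ m ≤ x.1.card}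
      {w | IsWordOn S w ∧ stat w = i ∧ m ≤ (wave w).length} := by
  have hb := hc.bijOn hS
  refine ⟨fun x hx => ⟨(hb.mapsTo hx.1).1, ?_, ?_⟩, hb.injOn.mono fun x hx => hx.1, fun w hw => ?_⟩
  · rw [hc.stat_code hS hx.1, hx.2.1]
  · rw [hc.length_wave_code hS hx.1]
    exact hx.2.2
  · obtain ⟨x, hx, rfl⟩ := hb.surjOn ⟨hw.1, fun h => by
      have := hc.stat_of_pairwise _ h
      have := hw.2.1
      omega⟩
    refine ⟨x, ⟨hx, ?_, ?_⟩, rfl⟩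
    · rw [← hc.stat_code hS hx, hw.2.1]
    · rw [← hc.length_wave_code hS hx]
      exact hw.2.2

/-- Replacing the inserted-into word by one with the same statistic. -/
theorem bijOn_triples {stat₁ stat₂ : List ℕ → ℕ} {S : Finset ℕ} {f : Finset ℕ → List ℕ → List ℕ}
    (hf : ∀ T ⊂ S, Set.BijOn (f T) {w | IsWordOn T w} {w | IsWordOn T w})
    (hs : ∀ T ⊂ S, ∀ w, IsWordOn T w → stat₂ (f T w) = stat₁ w) (i m : ℕ) :
    Set.BijOn (fun x => (x.1, x.2.1, f (S \ x.1) x.2.2))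
      {x | x ∈ triples S ∧ x.2.1 + stat₁ x.2.2 = i ∧ m ≤ x.1.card}
      {x | x ∈ triples S ∧ x.2.1 + stat₂ x.2.2 = i ∧ m ≤ x.1.card} := by
  have hlt : ∀ x ∈ triples S, S \ x.1 ⊂ S := fun x hx =>
    Finset.sdiff_ssubset hx.1 (Finset.card_pos.1 (by have := hx.2.2.1; omega))
  refine ⟨?_, ?_, ?_⟩
  · rintro x ⟨hx, h1, h2⟩
    refine ⟨⟨hx.1, hx.2.1, hx.2.2.1, (hf _ (hlt x hx)).mapsTo hx.2.2.2⟩, ?_, h2⟩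
    change x.2.1 + stat₂ (f _ _) = i
    rw [hs _ (hlt x hx) _ hx.2.2.2, h1]
  · rintro ⟨P, j, v⟩ ⟨hx, -⟩ ⟨P', j', v'⟩ ⟨hx', -⟩ h
    simp only [Prod.mk.injEq] at h
    obtain ⟨rfl, rfl, h⟩ := h
    have hv : v = v' := (hf _ (hlt _ hx)).injOn hx.2.2.2 hx'.2.2.2 h
    rw [hv]
  · rintro ⟨P, j, v⟩ ⟨hx, h1, h2⟩
    have hT : S \ P ⊂ S := hlt _ hx
    obtain ⟨v', hv, h⟩ := (hf _ hT).surjOn hx.2.2.2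
    refine ⟨(P, j, v'), ⟨⟨hx.1, hx.2.1, hx.2.2.1, hv⟩, ?_, h2⟩, by simp [h]⟩
    change j + stat₁ v' = i
    rw [← hs _ hT _ hv, h]
    exact h1

/-- Two statistics that admit wave codings are equidistributed. -/
theorem exists_bijOn {stat₁ stat₂ : List ℕ → ℕ} {wave₁ wave₂ : List ℕ → List ℕ}
    {code₁ code₂ : Finset ℕ × ℕ × List ℕ → List ℕ} (h₁ : IsWaveCoding stat₁ wave₁ code₁)
    (h₂ : IsWaveCoding stat₂ wave₂ code₂) (S : Finset ℕ) (hS : 0 ∉ S) :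
    ∃ f : List ℕ → List ℕ, Set.BijOn f {w | IsWordOn S w} {w | IsWordOn S w} ∧
      ∀ w, IsWordOn S w → stat₂ (f w) = stat₁ w := by
  classical
  induction S using Finset.strongInduction with
  | H S ih =>
    -- The map is made total in `T`, with `id` as a dummy value, so that `choose` gives one function
    -- of the set alone.
    have ih' : ∀ T : Finset ℕ, ∃ f : List ℕ → List ℕ, T ⊂ S →
        Set.BijOn f {w | IsWordOn T w} {w | IsWordOn T w} ∧
        ∀ w, IsWordOn T w → stat₂ (f w) = stat₁ w := by
      intro T
      by_cases hT : T ⊂ S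
      · obtain ⟨f, hf⟩ := ih T hT fun h => hS (hT.1 h)
        exact ⟨f, fun _ => hf⟩
      · exact ⟨id, fun h => absurd h hT⟩
    choose f hf using ih'
    have hfib : ∀ i, ∃ g : List ℕ → List ℕ, Set.BijOn g {w | IsWordOn S w ∧ stat₁ w = i}
        {w | IsWordOn S w ∧ stat₂ w = i} := by
      intro i
      rcases Nat.eq_zero_or_pos i with rfl | hi
      · have hz : ∀ {stat wave code}, IsWaveCoding stat wave code →
            {w | IsWordOn S w ∧ stat w = 0} = {w | IsWordOn S w ∧ w.Pairwise (· < ·)} := by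
          intro stat wave code h
          ext w
          refine and_congr_right fun hw => ⟨fun h0 => ?_, h.stat_of_pairwise w⟩
          by_contra hp
          obtain ⟨x, hx, rfl⟩ := (h.bijOn hS).surjOn ⟨hw, hp⟩
          have := h.stat_code hS hx
          have := hx.2.1
          omega
        rw [hz h₁, hz h₂]
        exact ⟨id, Set.bijOn_id _⟩
      -- With length bound `0` the condition on the wave is void. The bijection on the fibre over
      -- `i` decodes with `code₁`, transforms `v` by induction, and encodes with `code₂`.
      · have hw : ∀ {stat : List ℕ → ℕ} {wave : List ℕ → List ℕ},
            {w | IsWordOn S w ∧ stat w = i} =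
            {w | IsWordOn S w ∧ stat w = i ∧ 0 ≤ (wave w).length} := by
          intros
          simp
        rw [@hw stat₁ wave₁, @hw stat₂ wave₂]
        exact ⟨_, (h₂.bijOn_of_pos hS hi 0).comp <|
          (bijOn_triples (fun T hT => (hf T hT).1) (fun T hT => (hf T hT).2) i 0).comp
            ((Set.bijOn_comm (h₁.bijOn_of_pos hS hi 0).invOn_invFunOn.symm).1
              (h₁.bijOn_of_pos hS hi 0))⟩
    choose g hg using hfib
    -- The bijections between fibres are glued; equal images have equal `stat₂`, so they come from
    -- the same fibre.
    refine ⟨fun w => g (stat₁ w) w, ⟨fun w hw => ((hg _).mapsTo ⟨hw, rfl⟩).1,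
      fun w hw w' hw' h => ?_, fun w hw => ?_⟩, fun w hw => ((hg _).mapsTo ⟨hw, rfl⟩).2⟩
    · have e1 := ((hg _).mapsTo ⟨hw, rfl⟩).2
      have e2 := ((hg _).mapsTo ⟨hw', rfl⟩).2
      have e : stat₁ w = stat₁ w' := by
        rw [← e1, ← e2]
        exact congrArg _ h
      exact (hg (stat₁ w)).injOn ⟨hw, rfl⟩ ⟨hw', e.symm⟩ (by simpa [e] using h)
    · obtain ⟨v, hv, hvw⟩ := (hg (stat₂ w)).surjOn ⟨hw, rfl⟩
      exact ⟨v, hv.1, by simpa [hv.2] using hvw⟩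

/-- The bijections of `exists_bijOn` ignore wave lengths, but here they act only on `v`. The wave of
the coded word has length `#P`, which is untouched. -/
theorem mk_eq {stat₁ stat₂ : List ℕ → ℕ} {wave₁ wave₂ : List ℕ → List ℕ}
    {code₁ code₂ : Finset ℕ × ℕ × List ℕ → List ℕ} (h₁ : IsWaveCoding stat₁ wave₁ code₁)
    (h₂ : IsWaveCoding stat₂ wave₂ code₂) {S : Finset ℕ} (hS : 0 ∉ S) {i : ℕ} (hi : 0 < i)
    (m : ℕ) :
    Cardinal.mk {w | IsWordOn S w ∧ stat₁ w = i ∧ m ≤ (wave₁ w).length} =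
      Cardinal.mk {w | IsWordOn S w ∧ stat₂ w = i ∧ m ≤ (wave₂ w).length} := by
  have ih : ∀ T : Finset ℕ, ∃ f : List ℕ → List ℕ, T ⊂ S →
      Set.BijOn f {w | IsWordOn T w} {w | IsWordOn T w} ∧
      ∀ w, IsWordOn T w → stat₂ (f w) = stat₁ w := by
    intro T
    by_cases hT : T ⊂ S
    · obtain ⟨f, hf⟩ := exists_bijOn h₁ h₂ T fun h => hS (hT.1 h)
      exact ⟨f, fun _ => hf⟩
    · exact ⟨id, fun h => absurd h hT⟩
  choose f hf using ih
  exact ((Cardinal.mk_congr (h₁.bijOn_of_pos hS hi m).equiv).symm.trans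
    (Cardinal.mk_congr
      (bijOn_triples (fun T hT => (hf T hT).1) (fun T hT => (hf T hT).2) i m).equiv)).trans
    (Cardinal.mk_congr (h₂.bijOn_of_pos hS hi m).equiv)

end IsWaveCoding

/-! ### Cutting words at descents, thresholds and maximal runs. -/

theorem pairwise_append_singleton {R : ℕ → ℕ → Prop} {l : List ℕ} {x : ℕ} :
    (l ++ [x]).Pairwise R ↔ l.Pairwise R ∧ ∀ y ∈ l, R y x := by
  simp [List.pairwise_append]

theorem IsWordOn.not_mem_zero {S : Finset ℕ} (hS : 0 ∉ S) {w : List ℕ} (h : IsWordOn S w) :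
    0 ∉ w := fun h0 => hS ((h.mem_iff 0).1 h0)

theorem toFinset_sort_of_pairwise {l : List ℕ} (h : l.Pairwise (· < ·)) : l.toFinset.sort = l :=
  (List.toFinset_sort (· ≤ ·) (h.imp ne_of_lt)).2 (h.imp le_of_lt)

theorem pairwise_sort_lt (P : Finset ℕ) : P.sort.Pairwise (· < ·) :=
  P.sortedLT_sort.pairwise

theorem mem_triples {S : Finset ℕ} {l u W v : List ℕ} {j : ℕ} (hl : l.Pairwise (· < ·))
    (hW : W.Perm l) (hw : IsWordOn S (u ++ W ++ v)) (hj : 1 ≤ j) (hjl : j < l.length) :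
    (l.toFinset, j, u ++ v) ∈ triples S := by
  have hval : l.toFinset.val = (W : Multiset ℕ) := by
    rw [List.toFinset_val, (show l.Nodup from hl.imp ne_of_lt).dedup]
    exact (Multiset.coe_eq_coe.2 hW).symm
  refine ⟨fun x hx => ?_, hj, ?_, ?_⟩
  · rw [List.mem_toFinset] at hx
    exact (hw.mem_iff x).1 (by simp [hW.mem_iff, hx])
  · rw [List.toFinset_card_of_nodup (hl.imp ne_of_lt)]
    exact hjl
  · rw [IsWordOn, Finset.sdiff_val, ← show _ = S.val from hw, hval, ← Multiset.coe_add,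
      ← Multiset.coe_add, ← Multiset.coe_add, add_right_comm, add_tsub_cancel_right]

theorem exists_first_descent {w : List ℕ} (hnd : w.Nodup) (h : ¬ w.Pairwise (· < ·)) :
    ∃ a x y r, w = a ++ x :: y :: r ∧ (a ++ [x]).Pairwise (· < ·) ∧ y < x := by
  induction w with
  | nil => simp at h
  | cons c w ih =>
    cases w with
    | nil => simp at h
    | cons b w =>
      rcases lt_trichotomy b c with hbc | rfl | hcb
      · exact ⟨[], c, b, w, rfl, by simp, hbc⟩
      · simp at hnd
      · have hw : ¬ (b :: w).Pairwise (· < ·) := fun hw => h <| by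
          rw [← List.isChain_iff_pairwise] at hw ⊢
          exact List.isChain_cons_cons.2 ⟨hcb, hw⟩
        obtain ⟨a, x, y, r, h1, h2, h3⟩ := ih (List.nodup_cons.1 hnd).2 hw
        refine ⟨c :: a, x, y, r, by rw [h1]; rfl, ?_, h3⟩
        rw [← List.isChain_iff_pairwise] at h2 ⊢
        cases a with
        | nil =>
          simp only [List.nil_append, List.cons.injEq] at h1
          simpa [← h1.1] using hcb
        | cons a' a =>
          simp only [List.cons_append, List.cons.injEq] at h1 h2 ⊢
          exact List.isChain_cons_cons.2 ⟨h1.1 ▸ hcb, h2⟩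

theorem exists_split_pairwise {l : List ℕ} (hl : l.Pairwise (· < ·)) {z : ℕ} (hz : z ∉ l) :
    ∃ a b, l = a ++ b ∧ (∀ x ∈ a, x < z) ∧ ∀ x ∈ b, z < x := by
  induction l with
  | nil => exact ⟨[], [], rfl, by simp, by simp⟩
  | cons c l ih =>
    rw [List.pairwise_cons] at hl
    rw [List.mem_cons, not_or] at hz
    rcases lt_or_gt_of_ne hz.1 with h | h
    · refine ⟨[], c :: l, rfl, by simp, fun x hx => ?_⟩
      rcases List.mem_cons.1 hx with rfl | hx
      · exact h
      · exact h.trans (hl.1 x hx)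
    · obtain ⟨a, b, rfl, h1, h2⟩ := ih hl.2 hz.2
      refine ⟨c :: a, b, rfl, fun x hx => ?_, h2⟩
      rcases List.mem_cons.1 hx with rfl | hx
      · exact h
      · exact h1 x hx

/-- The maximal decreasing continuation above the bound `p`. -/
theorem exists_maximal_decreasing (p z : ℕ) (hz : p < z) (rest : List ℕ) :
    ∃ d v, rest = d ++ v ∧ (z :: d).Pairwise (· > ·) ∧ (∀ x ∈ z :: d, p < x) ∧
      ∀ q ∈ v.head?, q < (z :: d).getLastD 0 → q ≤ p := by
  induction rest generalizing z with
  | nil => exact ⟨[], [], rfl, by simp, by simpa using hz, by simp⟩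
  | cons q rest ih =>
    by_cases hq : q < z ∧ p < q
    · obtain ⟨d, v, rfl, h1, h2, h3⟩ := ih q hq.2
      refine ⟨q :: d, v, rfl, ?_, ?_, by simpa using h3⟩
      · rw [← List.isChain_iff_pairwise] at h1 ⊢
        exact List.isChain_cons_cons.2 ⟨hq.1, h1⟩
      · intro x hx
        rcases List.mem_cons.1 hx with rfl | hx
        · exact hz
        · exact h2 x hx
    · refine ⟨[], q :: rest, rfl, by simp, by simpa using hz, ?_⟩
      simp only [List.head?_cons, Option.mem_def, Option.some.injEq, List.getLastD_cons,
        List.getLastD_nil]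
      rintro _ rfl h
      omega

theorem getLastD_le_of_pairwise_gt {d : List ℕ} (hd : d.Pairwise (· > ·)) :
    ∀ x ∈ d, d.getLastD 0 ≤ x := by
  rcases List.eq_nil_or_concat d with rfl | ⟨d, y, rfl⟩
  · simp
  · rw [List.concat_eq_append, List.pairwise_append] at hd
    intro x hx
    rw [List.concat_eq_append] at hx ⊢
    rcases List.mem_append.1 hx with hx | hx
    · simpa using (hd.2.2 x hx y (by simp)).le
    · simp_all

theorem le_getLastD_of_pairwise_lt {d : List ℕ} (hd : d.Pairwise (· < ·)) :
    ∀ x ∈ d, x ≤ d.getLastD 0 := by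
  rcases List.eq_nil_or_concat d with rfl | ⟨d, y, rfl⟩
  · simp
  · rw [List.concat_eq_append, List.pairwise_append] at hd
    intro x hx
    rw [List.concat_eq_append] at hx ⊢
    rcases List.mem_append.1 hx with hx | hx
    · simpa using (hd.2.2 x hx y (by simp)).le
    · simp_all

theorem getLastD_mem {d : List ℕ} (hd : d ≠ []) : d.getLastD 0 ∈ d := by
  rcases List.eq_nil_or_concat d with rfl | ⟨d, y, rfl⟩
  · simp at hd
  · simp

theorem exists_eq_append_cons_of_lt_length (l : List ℕ) {i : ℕ} (hi : i < l.length) :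
    ∃ u x r, l = u ++ x :: r ∧ u.length = i :=
  ⟨l.take i, l[i], l.drop (i + 1), by rw [List.getElem_cons_drop, List.take_append_drop], by
    simp; omega⟩

theorem exists_sort_split (P : Finset ℕ) {i : ℕ} (hi : i < P.card) :
    ∃ u x r, P.sort = u ++ x :: r ∧ u.length = i :=
  exists_eq_append_cons_of_lt_length _ (by rwa [Finset.length_sort])

theorem des_cons_of_lt_head {x : ℕ} {v : List ℕ} (h : ∀ q ∈ v.head?, x < q) :
    des (x :: v) = des v := by
  cases v with
  | nil => rfl
  | cons q v => rw [des_cons_cons, if_neg (not_lt.2 (h q (by simp)).le), zero_add]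

theorem des_append_of_pairwise_gt {d : List ℕ} {q : ℕ} {v : List ℕ} (hne : d ≠ [])
    (hd : d.Pairwise (· > ·)) (hq : q < d.getLastD 0) :
    des (d ++ q :: v) = d.length + des (q :: v) := by
  obtain ⟨x, d, rfl⟩ := List.exists_cons_of_ne_nil hne
  rw [des_append_cons, List.cons_append, des_cons_of_pairwise_gt]
  · simp
  · rw [← List.cons_append, List.pairwise_append]
    refine ⟨hd, by simp, fun y hy z hz => ?_⟩
    rw [List.mem_singleton] at hz
    exact hz ▸ hq.trans_le (getLastD_le_of_pairwise_gt hd y hy)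

/-- The letters of `u` lie below everything up to `c`, so they start no descent, while every letter
of the decreasing block starts one, the last of them descending to `c`. It serves both the wave
coding and the words of semipermutations. -/
theorem des_append_reverse_append_cons {u r : List ℕ} {c : ℕ} (hu : u.Pairwise (· < ·))
    (huc : ∀ x ∈ u, x < c) (hur : ∀ x ∈ u, ∀ y ∈ r, x < y) (hr : (c :: r).Pairwise (· < ·))
    (v : List ℕ) : des (u ++ r.reverse ++ c :: v) = r.length + des (c :: v) := by
  rw [List.pairwise_cons] at hr
  rcases eq_or_ne r [] with rfl | hr0
  · simp only [List.reverse_nil, List.append_nil, List.length_nil, zero_add]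
    rw [des_append_cons, des_eq_zero_of_pairwise (pairwise_append_singleton.2 ⟨hu, huc⟩), zero_add]
  · have hr0 : r.reverse ≠ [] := by simpa using hr0
    obtain ⟨p, t, ht⟩ := List.exists_cons_of_ne_nil hr0
    have hu1 : (u ++ [p]).Pairwise (· < ·) := pairwise_append_singleton.2
      ⟨hu, fun y hy => hur y hy p (by rw [← List.mem_reverse, ht]; simp)⟩
    rw [List.append_assoc, ht, List.cons_append, des_append_cons, des_eq_zero_of_pairwise hu1,
      zero_add, ← List.cons_append, ← ht, des_append_of_pairwise_gt hr0
      (List.pairwise_reverse.2 hr.2) (hr.1 _ (List.mem_reverse.1 (getLastD_mem hr0))),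
      List.length_reverse]

/-! ### The coding of special reverse waves -/

/-- The word in which the letters of `P` form a special reverse wave followed by `v`. -/
def srwCode (x : Finset ℕ × ℕ × List ℕ) : List ℕ :=
  let l := x.1.sort
  let s := l.length - x.2.1 - 1
  let c := l.getD s 0
  if ∀ q ∈ x.2.2.head?, c < q then l.take s ++ (l.drop (s + 1)).reverse ++ c :: x.2.2
  else l.take s ++ c :: (l.drop (s + 1)).reverse ++ x.2.2

/-- The pivot `c` has exactly `j` letters of `P` above it. If `v` is empty or starts above `c`, then
`c` ends the wave and the wave stops because the word ends or rises. Otherwise `c` precedes the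
peak, and the wave stops because the next letter falls below `c`, the letter before the first
descent. -/
theorem srwCode_eq {P : Finset ℕ} {u r v : List ℕ} {c : ℕ} (h : P.sort = u ++ c :: r) :
    srwCode (P, r.length, v) = if ∀ q ∈ v.head?, c < q then u ++ r.reverse ++ c :: v
      else u ++ c :: r.reverse ++ v := by
  have hs : (u ++ c :: r).length - r.length - 1 = u.length := by simp; omega
  simp only [srwCode, h, hs]
  have h1 : (u ++ c :: r).getD u.length 0 = c := by simp
  have h2 : (u ++ c :: r).drop (u.length + 1) = r := by
    rw [← List.singleton_append, ← List.append_assoc, List.drop_left' (by simp)]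
  rw [h1, h2, List.take_left' rfl]

theorem isWaveCoding_srw : IsWaveCoding des srw srwCode where
  stat_of_pairwise _ := des_eq_zero_of_pairwise
  code_eq := by
    rintro S hS ⟨P, j, v⟩ ⟨hP, hj, hjP, hv⟩
    dsimp only at hP hj hjP hv ⊢
    -- The index leaves exactly `j` letters above `c`.
    obtain ⟨u, c, r, hl, hu⟩ := exists_sort_split P (i := P.card - j - 1) (by omega)
    have hlen := congrArg List.length hl
    simp only [Finset.length_sort, List.length_append, List.length_cons] at hlen
    obtain rfl : j = r.length := by omega
    have hs := pairwise_sort_lt P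
    have hmem : ∀ y, y ∈ u ++ c :: r ↔ y ∈ P := fun y => by rw [← hl, Finset.mem_sort]
    have hcP : c ∈ P := (hmem c).1 (by simp)
    have hc0 : 0 < c := Nat.pos_of_ne_zero fun h => hS (h ▸ hP hcP)
    have hcv : ∀ q ∈ v.head?, q ≠ c := fun q hq h => by
      have := (hv.mem_iff q).1 (List.mem_of_mem_head? hq)
      exact (Finset.mem_sdiff.1 this).2 (h ▸ hcP)
    rw [hl, List.pairwise_append, List.pairwise_cons] at hs
    obtain ⟨hu', ⟨hcr, hr⟩, hur⟩ := hs
    have hr0 : r ≠ [] := by rintro rfl; simp at hj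
    have hrr : r.reverse.Pairwise (· > ·) := List.pairwise_reverse.2 hr
    have hlast : c < r.reverse.getLastD 0 :=
      hcr _ (List.mem_reverse.1 (getLastD_mem (by simpa using hr0)))
    rw [srwCode_eq hl, hl]
    split_ifs with hq
    · have hd : (r.reverse ++ [c]).Pairwise (· > ·) := by
        rw [List.pairwise_append]
        exact ⟨hrr, by simp, fun y hy z hz => by
          rw [List.mem_singleton] at hz
          exact hz ▸ hcr y (List.mem_reverse.1 hy)⟩
      refine ⟨[], u ++ (r.reverse ++ [c]), v, rfl, ?_, by simp, ?_, ?_⟩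
      · refine List.Perm.append_left _ ?_
        exact (List.perm_append_singleton _ _).trans ((List.reverse_perm r).cons c)
      · rw [show u ++ r.reverse ++ c :: v = u ++ (r.reverse ++ [c]) ++ v by simp]
        refine srw_append_of_maximal u _ v hu' (by simp) hd ?_ (by simpa using hc0) ?_
          (Or.inl (by simp; omega))
        · intro x hx y hy
          exact hur x hx y (by simpa [or_comm] using hy)
        · intro q hqv hqc
          have := hq q hqv
          simp at hqc
          omega
      · rw [des_append_reverse_append_cons hu' (fun y hy => hur y hy c (by simp))
          (fun y hy z hz => hur y hy z (by simp [hz])) (List.pairwise_cons.2 ⟨hcr, hr⟩),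
          des_cons_of_lt_head hq]
    · push Not at hq
      obtain ⟨q, hqv, hqc⟩ := hq
      have hqc' : q < c := lt_of_le_of_ne hqc (hcv q hqv)
      have hu1 : (u ++ [c]).Pairwise (· < ·) :=
        pairwise_append_singleton.2 ⟨hu', fun y hy => hur y hy c (by simp)⟩
      refine ⟨[], u ++ c :: r.reverse, v, rfl, ?_, by simp, ?_, ?_⟩
      · exact ((List.reverse_perm r).cons c).append_left _
      · rw [show u ++ c :: r.reverse = u ++ [c] ++ r.reverse by simp]
        refine srw_append_of_maximal (u ++ [c]) _ v hu1 (by simpa using hr0) hrr ?_ (by omega) ?_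
          (Or.inr ⟨q, hqv, by omega⟩)
        · intro x hx y hy
          rcases List.mem_append.1 hx with hx | hx
          · exact hur x hx y (List.mem_cons_of_mem _ (List.mem_reverse.1 hy))
          · rw [List.mem_singleton] at hx
            exact hx ▸ hcr y (List.mem_reverse.1 hy)
        · intro q' hq' _
          rw [Option.mem_def] at hq' hqv
          rw [hqv, Option.some.injEq] at hq'
          simp
          omega
      · obtain ⟨p, t, ht⟩ := List.exists_cons_of_ne_nil (l := r.reverse) (by simpa using hr0)
        obtain ⟨v, rfl⟩ : ∃ v', v = q :: v' := by
          cases v with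
          | nil => simp at hqv
          | cons a v => exact ⟨v, by rw [Option.some.inj hqv]⟩
        have hu2 : (u ++ [c] ++ [p]).Pairwise (· < ·) := by
          rw [List.pairwise_append]
          exact ⟨hu1, by simp, fun y hy z hz => by
            rw [List.mem_singleton] at hz
            have hz : z ∈ r := by rw [hz, ← List.mem_reverse, ht]; simp
            rcases List.mem_append.1 hy with hy | hy
            · exact hur y hy z (by simp [hz])
            · rw [List.mem_singleton] at hy
              exact hy ▸ hcr z hz⟩
        rw [show u ++ c :: r.reverse ++ q :: v = u ++ [c] ++ p :: (t ++ q :: v) by simp [ht],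
          des_append_cons, des_eq_zero_of_pairwise hu2, zero_add, ← List.cons_append, ← ht,
          des_append_of_pairwise_gt (by simpa using hr0) hrr (by omega), List.length_reverse]
  surj := by
    intro S hS w hw hnp
    have h0 := hw.not_mem_zero hS
    obtain ⟨a, x, y, r, rfl, ha, hyx⟩ := exists_first_descent hw.nodup hnp
    rw [List.pairwise_append] at ha
    obtain ⟨ha, -, hax⟩ := ha
    have hax : ∀ z ∈ a, z < x := fun z hz => hax z hz x (by simp)
    have hpx : a.getLastD 0 < x := by
      rcases eq_or_ne a [] with rfl | h
      · exact Nat.pos_of_ne_zero fun h => h0 (by simp [h])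
      · exact hax _ (getLastD_mem h)
    obtain ⟨d, v, hr, hd, hpd, hv⟩ := exists_maximal_decreasing _ x hpx (y :: r)
    have had : ∀ z ∈ a, ∀ t ∈ x :: d, z < t := fun z hz t ht =>
      (le_getLastD_of_pairwise_lt ha z hz).trans_lt (hpd t ht)
    rw [hr] at hw h0 ⊢
    have hdr : (x :: d).reverse.Pairwise (· < ·) := List.pairwise_reverse.2 hd
    -- The reason for which the wave stops decides the branch of `srwCode`, and so whether `c` is
    -- the last letter of the wave or the letter before its peak.
    by_cases hq : ∀ q ∈ v.head?, (x :: d).getLastD 0 < q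
    · have hd0 : d ≠ [] := by
        rintro rfl
        rw [List.nil_append] at hr
        have := hq y (by simp [← hr])
        simp at this
        omega
      obtain ⟨d, c, rfl⟩ := (List.eq_nil_or_concat d).resolve_left hd0
      simp only [List.concat_eq_append] at *
      have hl : (a ++ c :: (x :: d).reverse).Pairwise (· < ·) := by
        rw [List.pairwise_append]
        exact ⟨ha, by simpa using hdr, fun z hz t ht => had z hz t (by
          simp only [List.mem_cons, List.mem_reverse, List.mem_append] at ht ⊢; tauto)⟩
      refine ⟨((a ++ c :: (x :: d).reverse).toFinset, (x :: d).reverse.length, v), ?_, ?_⟩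
      · refine mem_triples (u := []) (W := a ++ x :: (d ++ [c])) hl ?_ (by simpa using hw) ?_ ?_
        · refine List.Perm.append_left _ ?_
          rw [← List.cons_append]
          exact (List.perm_append_singleton _ _).trans ((List.reverse_perm _).symm.cons c)
        · simp
        · simp; omega
      · rw [srwCode_eq (toFinset_sort_of_pairwise hl), if_pos, List.reverse_reverse]
        · simp
        · intro q hqv
          have := hq q hqv
          rwa [← List.cons_append, List.getLastD_concat] at this
    · push Not at hq
      obtain ⟨q, hqv, hqd⟩ := hq
      have hqw : q ∈ v := List.mem_of_mem_head? hqv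
      have hqd' : q < (x :: d).getLastD 0 := lt_of_le_of_ne hqd fun h => by
        have hn := hw.nodup
        rw [← List.cons_append, List.nodup_append', List.nodup_append'] at hn
        exact hn.2.1.2.2 (h ▸ getLastD_mem (by simp)) hqw
      have hqa := hv q hqv hqd'
      -- For empty `a` the bound would be `w_0 = 0`, which the positive letter `q` exceeds.
      have ha0 : a ≠ [] := by
        rintro rfl
        simp at hqa
        exact h0 (by simp [← hqa, hqw])
      obtain ⟨a, c, rfl⟩ := (List.eq_nil_or_concat a).resolve_left ha0
      simp only [List.concat_eq_append] at *
      have hqc : ¬ ∀ q ∈ v.head?, c < q := fun h => by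
        have := h q hqv
        simp at hqa
        omega
      have hl : (a ++ c :: (x :: d).reverse).Pairwise (· < ·) := by
        rw [← List.singleton_append, ← List.append_assoc, List.pairwise_append]
        exact ⟨ha, hdr, fun z hz t ht => had z hz t (List.mem_reverse.1 ht)⟩
      refine ⟨((a ++ c :: (x :: d).reverse).toFinset, (x :: d).reverse.length, v), ?_, ?_⟩
      · refine mem_triples (u := []) (W := a ++ [c] ++ x :: d) hl ?_ (by simpa using hw) ?_ ?_
        · rw [List.append_assoc]
          exact ((List.reverse_perm _).symm.cons c).append_left _
        · simp
        · simp; omega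
      · rw [srwCode_eq (toFinset_sort_of_pairwise hl), if_neg hqc, List.reverse_reverse]
        simp

/-! ### The coding of special waves -/

/-- Insert `W` after the longest prefix of the word that is increasing with letters between
`p` and `m`. -/
def insertWave (W : List ℕ) (m : ℕ) : ℕ → List ℕ → List ℕ
  | _, [] => W
  | p, x :: v => if p < x ∧ x < m then x :: insertWave W m x v else W ++ x :: v

theorem insertWave_append (W : List ℕ) (m p : ℕ) (u v : List ℕ)
    (hu : (p :: u).Pairwise (· < ·)) (hm : ∀ x ∈ u, x < m)
    (hv : ∀ q ∈ v.head?, ¬ ((p :: u).getLastD 0 < q ∧ q < m)) :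
    insertWave W m p (u ++ v) = u ++ W ++ v := by
  induction u generalizing p with
  | nil =>
    cases v with
    | nil => simp [insertWave]
    | cons q v =>
      have := hv q rfl
      simp only [List.getLastD_cons, List.getLastD_nil] at this
      rw [List.nil_append, insertWave, if_neg this, List.nil_append]
  | cons x u ih =>
    rw [List.pairwise_cons] at hu
    rw [List.cons_append, insertWave, if_pos ⟨hu.1 x (by simp), hm x (by simp)⟩,
      ih x hu.2 (fun y hy => hm y (by simp [hy])) (by simpa using hv)]
    rfl

theorem exists_insertWave_eq (W : List ℕ) (m p : ℕ) (w : List ℕ) :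
    ∃ u v, w = u ++ v ∧ insertWave W m p w = u ++ W ++ v ∧ (p :: u).Pairwise (· < ·) ∧
      (∀ x ∈ u, x < m) ∧ ∀ q ∈ v.head?, ¬ ((p :: u).getLastD 0 < q ∧ q < m) := by
  induction w generalizing p with
  | nil => exact ⟨[], [], rfl, by simp [insertWave], by simp, by simp, by simp⟩
  | cons x w ih =>
    by_cases h : p < x ∧ x < m
    · obtain ⟨u, v, rfl, h1, h2, h3, h4⟩ := ih x
      refine ⟨x :: u, v, rfl, by rw [insertWave, if_pos h, h1]; rfl, ?_, ?_, by simpa using h4⟩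
      · rw [← List.isChain_iff_pairwise] at h2 ⊢
        exact List.isChain_cons_cons.2 ⟨h.1, h2⟩
      · intro y hy
        rcases List.mem_cons.1 hy with rfl | hy
        · exact h.2
        · exact h3 y hy
    · refine ⟨[], x :: w, rfl, by rw [insertWave, if_neg h]; rfl, by simp, by simp, ?_⟩
      simpa using h

/-- The word in which the letters of `P` form a special wave inserted into `v`. -/
def swCode (x : Finset ℕ × ℕ × List ℕ) : List ℕ :=
  insertWave (x.1.sort.drop x.2.1 ++ (x.1.sort.take x.2.1).reverse) (x.1.sort.getD 0 0) 0 x.2.2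

/-- The `j` smallest letters of `P` form the decreasing end of the wave and the others its
increasing start. The minimum `c` of `P` closes the wave and also bounds the letters of the prefix
after which it is inserted. -/
theorem swCode_eq {P : Finset ℕ} {c : ℕ} {u r : List ℕ} (h : P.sort = c :: u ++ r) (v : List ℕ) :
    swCode (P, u.length + 1, v) = insertWave (r ++ (c :: u).reverse) c 0 v := by
  simp [swCode, h]

theorem isWaveCoding_sw : IsWaveCoding des sw swCode where
  stat_of_pairwise _ := des_eq_zero_of_pairwise
  code_eq := by
    rintro S hS ⟨P, j, v⟩ ⟨hP, hj, hjP, hv⟩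
    dsimp only at hP hj hjP hv ⊢
    obtain ⟨u, y, r, hl, hu⟩ := exists_sort_split P (i := j) hjP
    obtain ⟨c, u, rfl⟩ := List.exists_cons_of_ne_nil (l := u) (by rintro rfl; simp at hu; omega)
    have hs := pairwise_sort_lt P
    have hmem : ∀ z, z ∈ c :: u ++ y :: r ↔ z ∈ P := fun z => by rw [← hl, Finset.mem_sort]
    have hcP : c ∈ P := (hmem c).1 (by simp)
    have hc0 : 0 < c := Nat.pos_of_ne_zero fun h => hS (h ▸ hP hcP)
    have hv0 := hv.not_mem_zero fun h => hS (Finset.mem_sdiff.1 h).1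
    have hcv : c ∉ v := fun h => (Finset.mem_sdiff.1 ((hv.mem_iff c).1 h)).2 hcP
    rw [hl, List.pairwise_append] at hs
    obtain ⟨hcu, hr, hur⟩ := hs
    rw [List.length_cons] at hu
    subst hu
    rw [swCode_eq hl, hl]
    obtain ⟨a, b, rfl, hab, ha0, ham, hb⟩ :=
      exists_insertWave_eq (y :: r ++ (c :: u).reverse) c 0 v
    rw [List.pairwise_cons] at ha0
    -- The inserted-into prefix `a` is maximal, so the letter after the wave is either above `c` or
    -- not above the last letter of `a`. In both cases the wave cannot be continued.
    have hbq : ∀ q ∈ b.head?, q ≤ a.getLastD 0 ∨ c < q := fun q hq => by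
      have h1 := hb q hq
      have h2 : q ≠ c := fun h => hcv (h ▸ by simp [List.mem_of_mem_head? hq])
      rw [List.getLastD_cons] at h1
      omega
    have hd : (c :: u).reverse.Pairwise (· > ·) := List.pairwise_reverse.2 hcu
    have hdl : (c :: u).reverse.getLastD 0 = c := by simp
    have hc : ∀ z ∈ y :: r, c < z := hur c (by simp)
    have hay : (a ++ y :: r).Pairwise (· < ·) := by
      rw [List.pairwise_append]
      exact ⟨ha0.2, hr, fun z hz t ht => (ham z hz).trans (hc t ht)⟩
    refine ⟨a, y :: r ++ (c :: u).reverse, b, rfl, ?_, hab, ?_, ?_⟩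
    · exact List.perm_append_comm.trans ((List.reverse_perm _).append_right _)
    · rw [hab, ← List.append_assoc]
      refine sw_append a (y :: r) _ b hay (by simp) (by simp) hd ?_ ?_ ?_
      · intro t ht z hz
        exact hur z (List.mem_reverse.1 hz) t ht
      · rw [hdl]
        rcases eq_or_ne a [] with rfl | ha
        · exact hc0
        · exact ham _ (getLastD_mem ha)
      · intro q hq hqc
        rw [hdl] at hqc
        have := hbq q hq
        omega
    · rw [hab]
      obtain ⟨r', x, hr'⟩ := (List.eq_nil_or_concat (y :: r)).resolve_left (by simp)
      rw [List.concat_eq_append] at hr'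
      have hx : ∀ z ∈ c :: u, z < x := fun z hz => hur z hz x (by simp [hr'])
      have hxd : (x :: (c :: u).reverse).Pairwise (· > ·) :=
        List.pairwise_cons.2 ⟨fun z hz => hx z (List.mem_reverse.1 hz), hd⟩
      rw [hr'] at hay ⊢
      rw [← List.append_assoc] at hay
      rw [show a ++ (r' ++ [x] ++ (c :: u).reverse) ++ b = a ++ r' ++ x :: ((c :: u).reverse ++ b) by
        simp, des_append_cons, des_eq_zero_of_pairwise hay, zero_add]
      cases b with
      | nil =>
        rw [List.append_nil, List.append_nil, des_eq_zero_of_pairwise ha0.2,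
          des_cons_of_pairwise_gt hxd]
        simp
      | cons q b =>
        have hqc : des (x :: (c :: u).reverse ++ q :: b) = u.length + 1 + des (c :: q :: b) := by
          rw [List.reverse_cons, ← List.cons_append, List.append_assoc, List.singleton_append,
            des_append_cons, List.cons_append, des_cons_of_pairwise_gt]
          · simp
          · simpa using hxd
        rw [← List.cons_append, hqc, des_append_cons a, des_cons_cons]
        -- The insertion replaces the junction of `a` and `q` by that of `c` and `q`. Both are
        -- descents if `q` is at most the last letter of `a`, and neither is if `c < q`.
        congr 2
        rcases hbq q rfl with h | h
        · have hq0 : 0 < q := Nat.pos_of_ne_zero fun h => hv0 (by simp [h])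
          have ha : a ≠ [] := by
            rintro rfl
            simp at h
            omega
          obtain ⟨a, z, rfl⟩ := (List.eq_nil_or_concat a).resolve_left ha
          simp only [List.concat_eq_append] at *
          have hzc := ham z (by simp)
          rw [List.getLastD_concat] at h
          have hzq : z ≠ q := by
            rintro rfl
            have := hv.nodup
            simp [List.nodup_append] at this
          rw [List.append_assoc, List.singleton_append, des_append_cons,
            des_eq_zero_of_pairwise ha0.2, des_cons_cons, if_pos (by omega), if_pos (by omega)]
          rfl
        · rw [if_neg (by omega), des_eq_zero_of_pairwise]
          exact pairwise_append_singleton.2 ⟨ha0.2, fun z hz => (ham z hz).trans h⟩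
  surj := by
    intro S hS w hw hnp
    have h0 := hw.not_mem_zero hS
    obtain ⟨a, x, y, r, rfl, ha, hyx⟩ := exists_first_descent hw.nodup hnp
    have hya : y ∉ a ++ [x] := fun h => by
      have hn := hw.nodup
      rw [← List.singleton_append, ← List.append_assoc, List.nodup_append'] at hn
      exact hn.2.2 h (by simp)
    -- The increasing prefix is cut at the threshold `y`, the letter after the first descent: `b` is
    -- the increasing start of the special wave, and the last letter of `a'` is the lower bound for
    -- its end.
    obtain ⟨a', b, hab, ha', hb⟩ := exists_split_pairwise ha hya
    have hb0 : b ≠ [] := by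
      rintro rfl
      rw [List.append_nil] at hab
      have := ha' x (by simp [← hab])
      omega
    have hp : a'.getLastD 0 < y := by
      rcases eq_or_ne a' [] with rfl | h
      · exact Nat.pos_of_ne_zero fun h => h0 (by simp [h])
      · exact ha' _ (getLastD_mem h)
    obtain ⟨d, v, rfl, hd, hpd, hv⟩ := exists_maximal_decreasing _ y hp r
    have hw' : a ++ x :: y :: (d ++ v) = a' ++ (b ++ y :: d) ++ v := by
      rw [← List.singleton_append, ← List.append_assoc, hab]
      simp
    rw [hab] at ha
    rw [hw'] at hw h0 ⊢
    obtain ⟨hsa, hsb, hsab⟩ := List.pairwise_append.1 ha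
    have hyd : ∀ z ∈ y :: d, z ≤ y := fun z hz => by
      rcases List.mem_cons.1 hz with rfl | hz
      · exact le_rfl
      · exact ((List.pairwise_cons.1 hd).1 z hz).le
    have hl : ((y :: d).reverse ++ b).Pairwise (· < ·) :=
      List.pairwise_append.2 ⟨List.pairwise_reverse.2 hd, hsb, fun z hz t ht =>
        (hyd z (List.mem_reverse.1 hz)).trans_lt (hb t ht)⟩
    obtain ⟨d', c, hdc⟩ := (List.eq_nil_or_concat (y :: d)).resolve_left (by simp)
    rw [List.concat_eq_append] at hdc
    have hlen : (y :: d).length = d'.reverse.length + 1 := by simp [hdc]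
    have hrev : (y :: d).reverse = c :: d'.reverse := by simp [hdc]
    have hlast : (y :: d).getLastD 0 = c := by rw [hdc, List.getLastD_concat]
    refine ⟨(((y :: d).reverse ++ b).toFinset, (y :: d).length, a' ++ v), ?_, ?_⟩
    · refine mem_triples hl ?_ hw (by simp) ?_
      · exact List.perm_append_comm.trans ((List.reverse_perm _).symm.append_right _)
      · have := List.length_pos_iff.2 hb0
        simp
        omega
    · rw [hlen, swCode_eq (by rw [toFinset_sort_of_pairwise hl, hrev]), ← hrev,
        List.reverse_reverse]
      have hcp := hpd c (by simp [hdc])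
      refine insertWave_append _ _ _ _ _ ?_ ?_ ?_
      · refine List.pairwise_cons.2 ⟨fun z hz => Nat.pos_of_ne_zero fun h => h0 ?_, hsa⟩
        simp [← h, hz]
      · exact fun z hz => (le_getLastD_of_pairwise_lt hsa z hz).trans_lt hcp
      -- The insertion stops at `a'`: a letter strictly between its last letter and `c` would have
      -- extended the decreasing end of the wave.
      · intro q hq h
        rw [List.getLastD_cons] at h
        have := hv q hq (by rw [hlast]; exact h.2)
        omega

/-! ### The coding of rightmost hooks -/

/-- The word in which the letters of `P` form a hook with `j` inversions that follows `v`. -/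
def hookCode (x : Finset ℕ × ℕ × List ℕ) : List ℕ :=
  x.2.2 ++ x.1.sort.getD x.2.1 0 :: (x.1.sort.take x.2.1 ++ x.1.sort.drop (x.2.1 + 1))

theorem hookCode_eq {P : Finset ℕ} {u r : List ℕ} {c : ℕ} (h : P.sort = u ++ c :: r)
    (v : List ℕ) : hookCode (P, u.length, v) = v ++ c :: (u ++ r) := by
  have h2 : (u ++ c :: r).drop (u.length + 1) = r := by
    rw [← List.singleton_append, ← List.append_assoc, List.drop_left' (by simp)]
  simp only [hookCode, h]
  rw [h2, List.take_left' rfl]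
  simp

/-- A hook on `P` is determined by its first letter, and its inversions are the pairs of that letter
with the smaller ones. Starting with the letter of rank `j` from `0` thus gives `j` inversions, and
`j ≥ 1` makes it a genuine hook. -/
theorem isWaveCoding_hook : IsWaveCoding lec rightmostHook hookCode where
  stat_of_pairwise _ := lec_of_pairwise
  code_eq := by
    rintro S hS ⟨P, j, v⟩ ⟨hP, hj, hjP, hv⟩
    dsimp only at hP hj hjP hv ⊢
    obtain ⟨u, c, r, hl, rfl⟩ := exists_sort_split P (i := j) hjP
    have hs := pairwise_sort_lt P
    rw [hl, List.pairwise_append, List.pairwise_cons] at hs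
    obtain ⟨hu, ⟨hcr, hr⟩, hur⟩ := hs
    have hsur : (u ++ r).Pairwise (· < ·) :=
      List.pairwise_append.2 ⟨hu, hr, fun x hx y hy => hur x hx y (by simp [hy])⟩
    have hinv : inv (c :: (u ++ r)) = u.length := by
      rw [inv_cons, inv_of_pairwise hsur, List.filter_append, List.filter_eq_self.2,
        List.filter_eq_nil_iff.2]
      · simp
      · intro y hy
        simpa using (hcr y hy).le
      · intro y hy
        simpa using hur y hy c (by simp)
    rw [hookCode_eq hl, hl]
    obtain ⟨b, u, rfl⟩ := List.exists_cons_of_ne_nil (l := u) (by rintro rfl; simp at hj)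
    have hf := hookFactorization_append_hook v c b (u ++ r) (hur b (by simp) c (by simp)) hsur
    rw [← List.cons_append] at hf
    refine ⟨v, c :: (b :: u ++ r), [], by simp, List.perm_middle.symm, by simp, ?_, ?_⟩
    · rw [rightmostHook, hf]
      simp
    · rw [lec, hf, List.map_append, List.sum_append, List.map_singleton, List.sum_singleton, hinv,
        add_comm]
      rfl
  surj := by
    intro S hS w hw hnp
    obtain ⟨h1, h2, h3⟩ := (isHookFactorization_iff hw.nodup _ _).2
      (rfl : hookFactorization w = ((hookFactorization w).1, (hookFactorization w).2))
    rcases List.eq_nil_or_concat (hookFactorization w).2 with h | ⟨αs, α, h⟩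
    · rw [h] at h1
      exact absurd (by rw [h1]; simpa using h2) hnp
    · rw [List.concat_eq_append] at h
      obtain ⟨a, b, v, rfl, hba, hbv⟩ := h3 α (by simp [h])
      rw [h] at h1
      generalize hg : (hookFactorization w).1 ++ αs.flatten = g
      have hwg : w = g ++ a :: b :: v := by
        rw [h1, ← hg]
        simp
      clear h1 h2 h3 h hg
      subst hwg
      have ha : a ∉ b :: v := by
        have := hw.nodup
        rw [List.nodup_append'] at this
        exact (List.nodup_cons.1 this.2.1).1
      -- The letters of the hook below its first letter `a` form `u`, and their number is `j`.
      obtain ⟨u, r, hur, hu, hr⟩ := exists_split_pairwise hbv ha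
      have hu0 : u ≠ [] := by
        rintro rfl
        rw [List.nil_append] at hur
        have := hr b (by simp [← hur])
        omega
      rw [hur] at hw hbv ⊢
      obtain ⟨hsu, hsr, hsur⟩ := List.pairwise_append.1 hbv
      have hl : (u ++ a :: r).Pairwise (· < ·) := by
        refine List.pairwise_append.2 ⟨hsu, List.pairwise_cons.2 ⟨hr, hsr⟩, fun x hx y hy => ?_⟩
        rcases List.mem_cons.1 hy with rfl | hy
        · exact hu x hx
        · exact hsur x hx y hy
      refine ⟨((u ++ a :: r).toFinset, u.length, g), ?_, ?_⟩
      · have := mem_triples (v := []) hl List.perm_middle.symm (by simpa using hw)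
          (List.length_pos_iff.2 hu0) (by simp)
        simpa using this
      · rw [hookCode_eq (toFinset_sort_of_pairwise hl)]

/-! ### Semipermutations and special reverse waves -/

theorem exists_srw_eq {w : List ℕ} (hw : w.Nodup) (h0 : 0 ∉ w) (hnp : ¬ w.Pairwise (· < ·)) :
    ∃ a x y r d v, w = a ++ x :: y :: r ∧ y < x ∧ y :: r = d ++ v ∧ a.Pairwise (· < ·) ∧
      (x :: d).Pairwise (· > ·) ∧ (∀ z ∈ a, ∀ t ∈ x :: d, z < t) ∧ srw w = a ++ x :: d := by
  obtain ⟨a, x, y, r, rfl, hax, hyx⟩ := exists_first_descent hw hnp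
  obtain ⟨ha, hx⟩ := pairwise_append_singleton.1 hax
  have hpx : a.getLastD 0 < x := by
    rcases eq_or_ne a [] with rfl | h
    · exact Nat.pos_of_ne_zero fun h => h0 (by simp [h])
    · exact hx _ (getLastD_mem h)
  obtain ⟨d, v, hr, hd, hpd, hv⟩ := exists_maximal_decreasing _ x hpx (y :: r)
  refine ⟨a, x, y, r, d, v, rfl, hyx, hr, ha, hd, fun z hz t ht =>
    (le_getLastD_of_pairwise_lt ha z hz).trans_lt (hpd t ht), ?_⟩
  have := srw_append a x y r (x :: d) v hax hyx (by rw [hr]; rfl) (by simp) hd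
    (hpd _ (getLastD_mem (by simp))) hv
  rwa [show a ++ x :: y :: r = a ++ x :: d ++ v by rw [hr]; simp]

theorem le_length_srw {u r v : List ℕ} {c : ℕ} (hu : u.Pairwise (· < ·)) (huc : ∀ x ∈ u, x < c)
    (hur : ∀ x ∈ u, ∀ y ∈ r, x < y) (hr : (c :: r).Pairwise (· < ·))
    (hw : (u ++ r.reverse ++ c :: v).Nodup) (h0 : 0 ∉ u ++ r.reverse ++ c :: v) :
    u.length + r.length < (srw (u ++ r.reverse ++ c :: v)).length := by
  rcases eq_or_ne r [] with rfl | hr0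
  · simp only [List.reverse_nil, List.append_nil, List.length_nil, add_zero] at hw h0 ⊢
    by_cases hp : (u ++ c :: v).Pairwise (· < ·)
    · rw [srw_of_pairwise hp]
      simp
    · obtain ⟨a, x, y, s, d, v', h1, hyx, -, -, -, -, h2⟩ := exists_srw_eq hw h0 hp
      rw [h2]
      -- Otherwise the first descent `x y` would lie inside the increasing word `u ++ [c]`.
      have : u.length ≤ a.length := by
        by_contra! hlt
        have hpre : a ++ [x, y] <+: u ++ [c] := by
          refine List.prefix_of_prefix_length_le (l₃ := u ++ c :: v) ?_ ?_ (by simp; omega)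
          · rw [h1]
            exact ⟨s, by simp⟩
          · exact ⟨v, by simp⟩
        have := (pairwise_append_singleton.2 ⟨hu, huc⟩).sublist hpre.sublist
        rw [List.pairwise_append] at this
        have := (List.pairwise_cons.1 this.2.1).1 y (by simp)
        omega
      simp
      omega
  · have hp : u.getLastD 0 < c := by
      rcases eq_or_ne u [] with rfl | h
      · exact Nat.pos_of_ne_zero fun h => h0 (by simp [h])
      · exact huc _ (getLastD_mem h)
    -- The decreasing block ending in `c` may continue into `v`; the wave is its maximal
    -- continuation and so contains at least the letters up to `c`.
    obtain ⟨d, v', rfl, hd, hpd, hv⟩ := exists_maximal_decreasing _ c hp v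
    rw [List.pairwise_cons] at hr
    have hlast : (r.reverse ++ c :: d).getLastD 0 = (c :: d).getLastD 0 := by
      obtain ⟨d', e, h⟩ := (List.eq_nil_or_concat (c :: d)).resolve_left (by simp)
      rw [h, List.concat_eq_append, ← List.append_assoc, List.getLastD_concat,
        List.getLastD_concat]
    have hr1 := List.length_pos_iff.2 hr0
    have key := srw_append_of_maximal u (r.reverse ++ c :: d) v' hu (by simp) ?_ ?_ ?_ ?_
      (Or.inl (by simp; omega))
    · rw [show u ++ r.reverse ++ c :: (d ++ v') = u ++ (r.reverse ++ c :: d) ++ v' by simp, key]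
      simp
    · refine List.pairwise_append.2 ⟨List.pairwise_reverse.2 hr.2, hd, fun x hx y hy => ?_⟩
      refine lt_of_le_of_lt ?_ (hr.1 x (List.mem_reverse.1 hx))
      rcases List.mem_cons.1 hy with rfl | hy
      · exact le_rfl
      · exact ((List.pairwise_cons.1 hd).1 y hy).le
    · intro x hx y hy
      rcases List.mem_append.1 hy with hy | hy
      · exact hur x hx y (List.mem_reverse.1 hy)
      · exact (le_getLastD_of_pairwise_lt hu x hx).trans_lt (hpd y hy)
    · rw [hlast]
      exact (Nat.zero_le _).trans_lt (hpd _ (getLastD_mem (by simp)))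
    · rwa [hlast]

/-- The letter `c` is the one after the first `m`. If it lies in the increasing part of the wave,
`r` is empty; if it lies in the decreasing part, `r` consists of the letters from the peak down to
just before `c`. -/
theorem exists_eq_of_lt_length_srw {w : List ℕ} (hw : w.Nodup) (h0 : 0 ∉ w) {m : ℕ}
    (hm : m < (srw w).length) :
    ∃ u c r v, w = u ++ r.reverse ++ c :: v ∧ u.length + r.length = m ∧ u.Pairwise (· < ·) ∧
      (∀ x ∈ u, x < c) ∧ (∀ x ∈ u, ∀ y ∈ r, x < y) ∧ (c :: r).Pairwise (· < ·) := by
  have hinc : ∀ l v : List ℕ, l.Pairwise (· < ·) → w = l ++ v → m < l.length →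
      ∃ u c r v, w = u ++ r.reverse ++ c :: v ∧ u.length + r.length = m ∧ u.Pairwise (· < ·) ∧
      (∀ x ∈ u, x < c) ∧ (∀ x ∈ u, ∀ y ∈ r, x < y) ∧ (c :: r).Pairwise (· < ·) := by
    rintro l v hl rfl hml
    obtain ⟨u, c, s, rfl, rfl⟩ := exists_eq_append_cons_of_lt_length l hml
    rw [List.pairwise_append] at hl
    exact ⟨u, c, [], s ++ v, by simp, by simp, hl.1, fun x hx => hl.2.2 x hx c (by simp),
      by simp, by simp⟩
  by_cases hp : w.Pairwise (· < ·)
  · rw [srw_of_pairwise hp] at hm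
    exact hinc w [] hp (by simp) hm
  · obtain ⟨a, x, y, s, d, v, hws, -, hd, ha, hxd, had, hsrw⟩ := exists_srw_eq hw h0 hp
    rcases lt_or_ge m a.length with hma | hma
    · exact hinc a _ ha hws hma
    · rw [hsrw, List.length_append] at hm
      obtain ⟨d₁, c, d₂, hd₁, hlen⟩ :=
        exists_eq_append_cons_of_lt_length (x :: d) (i := m - a.length) (by omega)
      rw [hd₁] at hxd had
      rw [List.pairwise_append] at hxd
      refine ⟨a, c, d₁.reverse, d₂ ++ v, ?_, by simp; omega, ha, fun z hz => had z hz c (by simp),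
        fun z hz t ht => had z hz t (by simp_all), ?_⟩
      · rw [hws, hd, ← List.cons_append, hd₁]
        simp
      · exact List.pairwise_cons.2 ⟨fun z hz => hxd.2.2 z (List.mem_reverse.1 hz) c (by simp),
          List.pairwise_reverse.2 hxd.1⟩

/-- The word of a semipermutation `(α₀, ρ)`: the letters of `α₀` below `ρ₁` in increasing order,
those above `ρ₁` in decreasing order, and `ρ`. -/
def semiWord (p : Finset ℕ × List ℕ) : List ℕ :=
  (p.1.filter (· < letter p.2 1)).sort ++ (p.1.filter (letter p.2 1 < ·)).sort.reverse ++ p.2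

theorem bijOn_semiWord {n k : ℕ} (hk : k < n) (i : ℕ) :
    Set.BijOn semiWord {p | p ∈ semiperms n (k + 1) ∧ semides p = i}
      {w | IsWordOn (Finset.Icc 1 n) w ∧ des w = i ∧ n - k ≤ (srw w).length} := by
  refine ⟨?_, ?_, ?_⟩
  · rintro ⟨α, ρ⟩ ⟨⟨hlen, hnd, hmem, hα⟩, hdes⟩
    dsimp only at hlen hnd hmem hα
    obtain ⟨c, v, rfl⟩ := List.exists_cons_of_length_eq_add_one hlen
    have hc : letter (c :: v) 1 = c := rfl
    have hαc : ∀ x ∈ α, x ≠ c := by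
      rintro x hx rfl
      rw [hα] at hx
      simp at hx
    have hword : IsWordOn (Finset.Icc 1 n) (semiWord (α, c :: v)) := by
      rw [isWordOn_iff, semiWord, List.nodup_append', List.nodup_append', hc]
      refine ⟨⟨⟨Finset.sort_nodup _ _, List.nodup_reverse.2 (Finset.sort_nodup _ _), ?_⟩, hnd, ?_⟩,
        fun x => ?_⟩
      · intro x h1 h2
        rw [List.mem_reverse, Finset.mem_sort, Finset.mem_filter] at h2
        rw [Finset.mem_sort, Finset.mem_filter] at h1
        omega
      · intro x h1 h2
        have : x ∈ α := by
          simp only [List.mem_append, List.mem_reverse, Finset.mem_sort, Finset.mem_filter] at h1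
          tauto
        rw [hα, Finset.mem_sdiff] at this
        exact this.2 (by simpa using h2)
      · simp only [List.mem_append, List.mem_reverse, Finset.mem_sort, Finset.mem_filter]
        constructor
        · rintro ((h | h) | h)
          · exact (Finset.mem_sdiff.1 (hα ▸ h.1)).1
          · exact (Finset.mem_sdiff.1 (hα ▸ h.1)).1
          · exact hmem x h
        · intro hx
          by_cases h : x ∈ c :: v
          · exact Or.inr h
          · have hxα : x ∈ α := by
              rw [hα, Finset.mem_sdiff, List.mem_toFinset]
              exact ⟨hx, h⟩
            exact Or.inl ((lt_or_gt_of_ne (hαc x hxα)).imp (⟨hxα, ·⟩) (⟨hxα, ·⟩))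
    have h1 := pairwise_sort_lt (α.filter (· < c))
    have h2 : ∀ x ∈ (α.filter (· < c)).sort, x < c := by simp
    have h3 : ∀ x ∈ (α.filter (c < ·)).sort, c < x := by simp
    have h4 : (c :: (α.filter (c < ·)).sort).Pairwise (· < ·) :=
      List.pairwise_cons.2 ⟨h3, pairwise_sort_lt _⟩
    have h5 : ∀ x ∈ (α.filter (· < c)).sort, ∀ y ∈ (α.filter (c < ·)).sort, x < y :=
      fun x hx y hy => (h2 x hx).trans (h3 y hy)
    refine ⟨hword, ?_, ?_⟩
    · rw [← hdes, semiWord, hc, des_append_reverse_append_cons h1 h2 h5 h4, Finset.length_sort,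
        semides, add_comm]
      rfl
    · have h6 := le_length_srw h1 h2 h5 h4 hword.nodup (hword.not_mem_zero (by simp))
      have h7 := hword.length_eq
      rw [semiWord, hc] at h7 ⊢
      dsimp only
      simp only [List.length_append, List.length_reverse, Nat.card_Icc] at h7 h6 hlen
      omega
  · rintro ⟨α, ρ⟩ ⟨⟨hlen, -, -, hα⟩, -⟩ ⟨α', ρ'⟩ ⟨⟨hlen', -, -, hα'⟩, -⟩ h
    dsimp only at hlen hlen' hα hα'
    -- The word ends in `ρ`, whose length `k + 1` is fixed, and `α₀` is its complement.
    have : ρ = ρ' := List.append_inj_right' h (hlen.trans hlen'.symm)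
    subst this
    rw [hα, hα']
  · rintro w ⟨hw, hdes, hsrw⟩
    -- The set `α₀` has `n - k - 1` elements; `k < n` turns the bound `n - k` into a strict
    -- inequality for this number.
    obtain ⟨u, c, r, v, rfl, hm, h1, h2, h3, h4⟩ :=
      exists_eq_of_lt_length_srw hw.nodup (hw.not_mem_zero (by simp)) (m := n - k - 1) (by omega)
    have hlen := hw.length_eq
    simp only [List.length_append, List.length_reverse, List.length_cons, Nat.card_Icc] at hlen
    have hnd := List.nodup_append'.1 hw.nodup
    have hrc := (List.pairwise_cons.1 h4).1
    have hf1 : (u ++ r).toFinset.filter (· < c) = u.toFinset := by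
      ext x
      simp only [Finset.mem_filter, List.mem_toFinset, List.mem_append]
      constructor
      · rintro ⟨h | h, hx⟩
        · exact h
        · exact absurd hx (hrc x h).le.not_gt
      · exact fun h => ⟨Or.inl h, h2 x h⟩
    have hf2 : (u ++ r).toFinset.filter (c < ·) = r.toFinset := by
      ext x
      simp only [Finset.mem_filter, List.mem_toFinset, List.mem_append]
      constructor
      · rintro ⟨h | h, hx⟩
        · exact absurd hx (h2 x h).le.not_gt
        · exact h
      · exact fun h => ⟨Or.inr h, hrc x h⟩
    have hrs := (List.pairwise_cons.1 h4).2
    refine ⟨((u ++ r).toFinset, c :: v), ⟨⟨by simp; omega, hnd.2.1, ?_, ?_⟩, ?_⟩, ?_⟩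
    · intro x hx
      exact (hw.mem_iff x).1 (List.mem_append_right _ hx)
    · ext x
      rw [Finset.mem_sdiff, ← hw.mem_iff x]
      simp only [List.mem_toFinset, List.mem_append, List.mem_reverse]
      have := @hnd.2.2 x
      simp only [List.mem_append, List.mem_reverse] at this
      tauto
    · rw [← hdes, des_append_reverse_append_cons h1 h2 h3 h4, semides, add_comm]
      congr 1
      change ((u ++ r).toFinset.filter (c < ·)).card = _
      rw [hf2, List.toFinset_card_of_nodup (hrs.imp ne_of_lt)]
    · change ((u ++ r).toFinset.filter (· < c)).sort ++
        ((u ++ r).toFinset.filter (c < ·)).sort.reverse ++ c :: v = _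
      rw [hf1, hf2, toFinset_sort_of_pairwise h1, toFinset_sort_of_pairwise hrs]

/-! ### Words of permutations -/

theorem isWordOn_word {n : ℕ} (σ : Equiv.Perm (Fin n)) : IsWordOn (Finset.Icc 1 n) (word σ) := by
  rw [isWordOn_iff, word]
  refine ⟨List.nodup_ofFn.2 fun a b h => σ.injective (Fin.ext (by simpa using h)), fun x => ?_⟩
  rw [List.mem_ofFn, Finset.mem_Icc]
  constructor
  · rintro ⟨j, rfl⟩
    have := (σ j).isLt
    omega
  · rintro ⟨h1, h2⟩
    refine ⟨σ.symm ⟨x - 1, by omega⟩, ?_⟩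
    simp
    omega

theorem bijOn_word (n : ℕ) :
    Set.BijOn (word (n := n)) Set.univ {w | IsWordOn (Finset.Icc 1 n) w} := by
  refine ⟨fun σ _ => isWordOn_word σ, fun σ _ τ _ h => ?_, fun w hw => ?_⟩
  · have := List.ofFn_injective h
    ext j
    simpa using congrFun this j
  · have hlen : w.length = n := by rw [hw.length_eq]; simp
    have hmem : ∀ j : Fin n, 1 ≤ w[j] ∧ w[j] ≤ n := fun j =>
      Finset.mem_Icc.1 ((hw.mem_iff _).1 (List.getElem_mem _))
    let f : Fin n → Fin n := fun j => ⟨w[j] - 1, by have := hmem j; omega⟩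
    have hf : Function.Injective f := by
      intro a b hab
      have h1 := hmem a
      have h2 := hmem b
      have h3 : w[a] - 1 = w[b] - 1 := congrArg Fin.val hab
      have h4 : w[a] = w[b] := by omega
      exact Fin.ext ((hw.nodup.getElem_inj_iff).1 h4)
    refine ⟨Equiv.ofBijective f (Finite.injective_iff_bijective.1 hf), trivial, ?_⟩
    refine List.ext_getElem (by simp [word, hlen]) fun j h1 h2 => ?_
    have := hmem ⟨j, by omega⟩
    simp only [Fin.getElem_fin] at this
    simp [word, f]
    omega

theorem mk_perm_eq (n : ℕ) (Q : List ℕ → Prop) :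
    Cardinal.mk {σ : Equiv.Perm (Fin n) // Q (word σ)} =
      Cardinal.mk {w | IsWordOn (Finset.Icc 1 n) w ∧ Q w} := by
  have h : Set.BijOn (word (n := n)) {σ | Q (word σ)} {w | IsWordOn (Finset.Icc 1 n) w ∧ Q w} := by
    refine ⟨fun σ hσ => ⟨isWordOn_word σ, hσ⟩, (bijOn_word n).injOn.mono (Set.subset_univ _), ?_⟩
    rintro w ⟨hw, hQ⟩
    obtain ⟨σ, -, rfl⟩ := (bijOn_word n).surjOn hw
    exact ⟨σ, hQ, rfl⟩
  exact Cardinal.mk_congr h.equiv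

end Eulerian

/-! ### The four equal cardinalities. -/

theorem mainTheorem1 (n k i : ℕ) (hk : k < n) (hi : 0 < i) :
    Cardinal.mk {p : Finset ℕ × List ℕ // p ∈ Eulerian.semiperms n (k + 1) ∧
        Eulerian.semides p = i} =
      Cardinal.mk {σ : Equiv.Perm (Fin n) // Eulerian.des (Eulerian.word σ) = i ∧
        n - k ≤ (Eulerian.srw (Eulerian.word σ)).length} ∧
    Cardinal.mk {σ : Equiv.Perm (Fin n) // Eulerian.des (Eulerian.word σ) = i ∧
        n - k ≤ (Eulerian.srw (Eulerian.word σ)).length} =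
      Cardinal.mk {σ : Equiv.Perm (Fin n) // Eulerian.des (Eulerian.word σ) = i ∧
        n - k ≤ (Eulerian.sw (Eulerian.word σ)).length} ∧
    Cardinal.mk {σ : Equiv.Perm (Fin n) // Eulerian.des (Eulerian.word σ) = i ∧
        n - k ≤ (Eulerian.sw (Eulerian.word σ)).length} =
      Cardinal.mk {σ : Equiv.Perm (Fin n) // Eulerian.lec (Eulerian.word σ) = i ∧
        n - k ≤ (Eulerian.rightmostHook (Eulerian.word σ)).length} := by
  have h0 : 0 ∉ Finset.Icc 1 n := by simp
  rw [Eulerian.mk_perm_eq n fun w => Eulerian.des w = i ∧ n - k ≤ (Eulerian.srw w).length,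
    Eulerian.mk_perm_eq n fun w => Eulerian.des w = i ∧ n - k ≤ (Eulerian.sw w).length,
    Eulerian.mk_perm_eq n fun w => Eulerian.lec w = i ∧ n - k ≤ (Eulerian.rightmostHook w).length]
  exact ⟨Cardinal.mk_congr (Eulerian.bijOn_semiWord hk i).equiv,
    Eulerian.isWaveCoding_srw.mk_eq Eulerian.isWaveCoding_sw h0 hi _,
    Eulerian.isWaveCoding_sw.mk_eq Eulerian.isWaveCoding_hook h0 hi _⟩
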